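/- For $a_+,a_->0$ put $a=(a_++a_-)/2$, $\alpha=2\pi/(a_+a_-)$, $\chi=\frac{\pi}{24}\big(\frac{a_+}{a_-}+\frac{a_-}{a_+}\big)$, $e_+(z)=\exp(\pi z/a_+)$ and $s=s(a_+,a_-)=\frac{a_+}{2\pi}\ln\frac1{a_-}$. Let $g(z)=g(a_+,a_-;z)$ be the logarithm of the hyperbolic gamma function $G=\exp(ig)$, that is, $$g(a_+,a_-;z)=\int_0^\infty\frac{dy}{y}\left(\frac{\sin 2yz}{2\sinh(a_+y)\sinh(a_-y)}-\frac{z}{a_+a_-y}\right),\qquad |\mathrm{Im}\,z|<a,$$ which continues holomorphically to the cut plane $\mathbb C\setminus\{z:\mathrm{Re}\,z=0,\ |\mathrm{Im}\,z|\ge a\}$; the continuation is again denoted by $g$. Put $$g_R(z)=g(z)+\chi+\alpha z^2/4,\qquad g_L(z)=g(z)-\chi-\alpha z^2/4 .$$ Fix $a_+>0$ and let $a_-\downarrow0$. (For $z$ in a compact set and $\lambda>0$, the points $z\pm\lambda s$ lie in the cut plane once $a_-$ is small enough.) (i) Let $\lambda>1/\sqrt2$ and let $\delta\in(1,\sqrt2)$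 satisfy $\delta\lambda>1$. Then $$g_R(a_+,a_-;z+\lambda s)=\frac{a_-^{\lambda}}{2\sin(\pi a_- /a_+)}\,e_+(-2z)+O\big(a_-^{\delta\lambda-1}\big),\qquad a_-\downarrow0,$$ with an implied constant that is uniform for $z$ in any given compact subset of $\mathbb C$ (it may depend on $a_+$, $\lambda$, $\delta$ and the compact set). (ii) Uniformly for $z$ in compact subsets of $\mathbb C$, $$\lim_{a_-\downarrow0}g_R(a_+,a_-;z+\lambda s)=\begin{cases}\frac{a_+}{2\pi}e_+(-2z),&\lambda=1,\\0,&\lambda>1,\end{cases}\qquad \lim_{a_-\downarrow0}g_L(a_+,a_-;z-\lambda s)=\begin{cases}-\frac{a_+}{2\pi}e_+(2z),&\lambda=1,\\0,&\lambda>1.\end{cases}$$ -/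

import Mathlib

open Set Filter Topology

noncomputable section

namespace HypGamma

/-- `α = 2π / (a₊ a₋)`. -/
def alpha (ap am : ℝ) : ℝ := 2 * Real.pi / (ap * am)

/-- `χ = (π / 24) (a₊ / a₋ + a₋ / a₊)`. -/
def chi (ap am : ℝ) : ℝ := Real.pi / 24 * (ap / am + am / ap)

/-- `e₊(z) = exp (π z / a₊)`. -/
def ePlus (ap : ℝ) (z : ℂ) : ℂ := Complex.exp (Real.pi * z / ap)

/-- `s(a₊, a₋) = (a₊ / 2π) ln (1 / a₋)`. -/
def sShift (ap am : ℝ) : ℝ := ap / (2 * Real.pi) * Real.log (1 / am)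

/-- The strip `S = {z : |Im z| < a}`, `a = (a₊ + a₋) / 2`. -/
def strip (ap am : ℝ) : Set ℂ := {z | |z.im| < (ap + am) / 2}

/-- The plane cut along `± i [a, ∞)`, `a = (a₊ + a₋) / 2`. The cuts contain all zeros and poles of
the hyperbolic gamma function. -/
def cutPlane (ap am : ℝ) : Set ℂ := {z | z.re = 0 ∧ (ap + am) / 2 ≤ |z.im|}ᶜ

/-- The integral that gives `g(a₊, a₋; z)`, where `G = exp (i g)` is the hyperbolic gamma function,
for `z` in the strip `S`. -/
def gIntegral (ap am : ℝ) (z : ℂ) : ℂ :=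
  ∫ y in Ioi (0 : ℝ), (1 / (y : ℂ)) *
    (Complex.sin (2 * y * z) / (2 * Complex.sinh (ap * y) * Complex.sinh (am * y))
      - z / (ap * am * y))

/-- `f` is a holomorphic function on the cut plane that is given on the strip by the integral
(by the identity theorem its values on the cut plane are unique). -/
def IsContinuation (ap am : ℝ) (f : ℂ → ℂ) : Prop :=
  DifferentiableOn ℂ f (cutPlane ap am) ∧ EqOn f (gIntegral ap am) (strip ap am)

/-- `g(a₊, a₋; ·)`: the holomorphic continuation to the cut plane of the integral on the strip.
The values on the cuts are irrelevant. -/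
def g (ap am : ℝ) : ℂ → ℂ := Classical.epsilon (IsContinuation ap am)

/-- `g_R(z) = g(z) + χ + α z² / 4`. -/
def gR (ap am : ℝ) (z : ℂ) : ℂ := g ap am z + chi ap am + alpha ap am * z ^ 2 / 4

/-- `g_L(z) = g(z) - χ - α z² / 4`. -/
def gL (ap am : ℝ) (z : ℂ) : ℂ := g ap am z - chi ap am - alpha ap am * z ^ 2 / 4

end HypGamma

end

namespace HypGamma

open MeasureTheory

/-! ### Elementary estimates -/

/-! The proof represents `gR` by a contour integral and moves the contour past one pole. Put `kernel
y = exp (2 i y z) / (y sinh (a₊ y) sinh (a₋ y))`. Its denominator is odd, so `kernel y + kernel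
(-y)` without its double pole is `4 i` times the integrand of `g`. For real `z = x ≥ 0`, lifting the
real line slightly past the triple pole at the origin adds the contribution of the `1 / y` term,
which is exactly `4 i (χ + α x² / 4)`; hence the lifted integral is `4 i gR`
(`tendsto_integral_kernel_near`).

Lifting further, to a height `r` between `π / a₊` and `2 π / a₊`, crosses only the simple pole `i π
/ a₊` when `a₋` is small. Its residue yields the main term `ePlus (-2 x) / (2 sin (π a₋ / a₊))`
(`tendsto_integral_kernel`).

What remains must be bounded for complex `z`, even with `|Im z| ≥ a`, where the horizontal integral
no longer converges. So both halves of the line are tilted upwards to slope `1`. On the tilted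
contour `|exp (2 i y z)| ≤ exp (-2 r Re z)` whenever `|Im z| ≤ Re z`, and the identity theorem
carries the formula from the positive axis to the cone `|Im z| < Re z`. Since `sinh (a₋ y)` is at
least a constant times `a₋` there, the remainder is `O (exp (-2 r Re z) / a₋)`, uniformly in `a₋`
(`exists_norm_gR_sub_le`).

With `r = δ π / a₊` and `z` replaced by `z + λ s`, this is `O (a₋ ^ (δ λ - 1))`, because `exp (-2 π
s / a₊) = a₋`. The limits follow from `sin t ~ t`, and those for `gL` from the oddness of `g`.

The continuation of `g` is obtained by rotating the ray of integration: along the direction `1 + τ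
i` the integral converges for `|Im z + τ Re z| < a`, and these tilted strips cover the cut plane. -/

theorem norm_sinh_sq (v : ℂ) :
    ‖Complex.sinh v‖ ^ 2 = Real.sinh v.re ^ 2 + Real.sin v.im ^ 2 := by
  have h : Complex.sinh v = ⟨Real.sinh v.re * Real.cos v.im, Real.cosh v.re * Real.sin v.im⟩ := by
    conv_lhs => rw [← Complex.re_add_im v, Complex.sinh_add, Complex.sinh_mul_I, Complex.cosh_mul_I]
    rw [← Complex.ofReal_sinh, ← Complex.ofReal_cosh, ← Complex.ofReal_cos, ← Complex.ofReal_sin]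
    apply Complex.ext <;> simp [-Complex.ofReal_sinh, -Complex.ofReal_cosh, -Complex.ofReal_cos,
      -Complex.ofReal_sin]
  rw [h, ← Complex.normSq_eq_norm_sq, Complex.normSq_mk]
  nlinarith [Real.cosh_sq v.re, Real.sin_sq_add_cos_sq v.im]

theorem abs_sinh_re_le (v : ℂ) : |Real.sinh v.re| ≤ ‖Complex.sinh v‖ := by
  refine abs_le_of_sq_le_sq ?_ (norm_nonneg _)
  rw [norm_sinh_sq]; nlinarith [sq_nonneg (Real.sin v.im)]

theorem abs_sin_im_le (v : ℂ) : |Real.sin v.im| ≤ ‖Complex.sinh v‖ := by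
  refine abs_le_of_sq_le_sq ?_ (norm_nonneg _)
  rw [norm_sinh_sq]; nlinarith [sq_nonneg (Real.sinh v.re)]

theorem abs_re_le_norm_sinh (v : ℂ) : |v.re| ≤ ‖Complex.sinh v‖ := by
  refine le_trans ?_ (abs_sinh_re_le v)
  rw [Real.abs_sinh]
  exact Real.self_le_sinh_iff.2 (abs_nonneg _)

theorem sinh_ne_zero_of_re {v : ℂ} (h : v.re ≠ 0) : Complex.sinh v ≠ 0 :=
  norm_pos_iff.1 ((abs_pos.2 h).trans_le (abs_re_le_norm_sinh v))

theorem sinh_ne_zero_of_im {v : ℂ} (h : Real.sin v.im ≠ 0) : Complex.sinh v ≠ 0 :=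
  norm_pos_iff.1 ((abs_pos.2 h).trans_le (abs_sin_im_le v))

theorem norm_sinh_sub_le (u : ℂ) : ‖Complex.sinh u - u‖ ≤ ‖u‖ ^ 3 * Real.exp ‖u‖ := by
  have h1 := Complex.norm_exp_sub_sum_le_norm_mul_exp u 3
  have h2 := Complex.norm_exp_sub_sum_le_norm_mul_exp (-u) 3
  rw [norm_neg] at h2
  have h : Complex.sinh u - u = ((Complex.exp u - ∑ m ∈ Finset.range 3, u ^ m / m.factorial)
      - (Complex.exp (-u) - ∑ m ∈ Finset.range 3, (-u) ^ m / m.factorial)) / 2 := by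
    simp [Finset.sum_range_succ, Complex.sinh, Nat.factorial]; ring
  rw [h, norm_div, Complex.norm_ofNat]
  have := norm_sub_le (Complex.exp u - ∑ m ∈ Finset.range 3, u ^ m / m.factorial)
    (Complex.exp (-u) - ∑ m ∈ Finset.range 3, (-u) ^ m / m.factorial)
  linarith

theorem norm_sinh_le (u : ℂ) : ‖Complex.sinh u‖ ≤ ‖u‖ * Real.exp ‖u‖ := by
  have h1 := Complex.norm_exp_sub_sum_le_norm_mul_exp u 1
  have h2 := Complex.norm_exp_sub_sum_le_norm_mul_exp (-u) 1
  rw [norm_neg] at h2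
  have h : Complex.sinh u = ((Complex.exp u - ∑ m ∈ Finset.range 1, u ^ m / m.factorial)
      - (Complex.exp (-u) - ∑ m ∈ Finset.range 1, (-u) ^ m / m.factorial)) / 2 := by
    simp [Complex.sinh]
  rw [h, norm_div, Complex.norm_ofNat]
  have := norm_sub_le (Complex.exp u - ∑ m ∈ Finset.range 1, u ^ m / m.factorial)
    (Complex.exp (-u) - ∑ m ∈ Finset.range 1, (-u) ^ m / m.factorial)
  simp only [pow_one] at *
  linarith

theorem norm_sin_sub_le (u : ℂ) : ‖Complex.sin u - u‖ ≤ ‖u‖ ^ 3 * Real.exp ‖u‖ := by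
  have h := norm_sinh_sub_le (u * Complex.I)
  rw [Complex.sinh_mul_I, ← sub_mul] at h
  simpa using h

theorem norm_sin_le (u : ℂ) : ‖Complex.sin u‖ ≤ Real.exp |u.im| := by
  have h : Complex.sin u = (Complex.exp (-u * Complex.I) - Complex.exp (u * Complex.I)) *
    Complex.I / 2 := rfl
  rw [h, norm_div, norm_mul, Complex.norm_I, Complex.norm_ofNat, mul_one]
  have h1 : ‖Complex.exp (-u * Complex.I)‖ ≤ Real.exp |u.im| := by
    rw [Complex.norm_exp]; apply Real.exp_le_exp.2; simpa using le_abs_self _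
  have h2 : ‖Complex.exp (u * Complex.I)‖ ≤ Real.exp |u.im| := by
    rw [Complex.norm_exp]; apply Real.exp_le_exp.2; simpa using neg_le_abs _
  have := norm_sub_le (Complex.exp (-u * Complex.I)) (Complex.exp (u * Complex.I))
  linarith

/-! ### Deforming contours -/

/-- Integrals of a holomorphic function along two rays from the origin into the right half-plane
agree if the function is `o(1/t)` on the sector between them. -/
theorem integral_ray_eq {f : ℂ → ℂ} {τ₀ τ₁ : ℝ} {b : ℝ → ℝ}
    (hf : DifferentiableOn ℂ f {y | 0 < y.re})
    (hb : ∀ t : ℝ, 0 < t → ∀ τ ∈ uIcc τ₀ τ₁, ‖f (t * (1 + τ * Complex.I))‖ ≤ b t)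
    (hb0 : Tendsto (fun t => t * b t) (𝓝[>] 0) (𝓝 0))
    (hb1 : Tendsto (fun t => t * b t) atTop (𝓝 0))
    (hi : IntegrableOn b (Ioi 0)) :
    ∫ t in Ioi (0 : ℝ), (1 + τ₀ * Complex.I) * f (t * (1 + τ₀ * Complex.I)) =
      ∫ t in Ioi (0 : ℝ), (1 + τ₁ * Complex.I) * f (t * (1 + τ₁ * Complex.I)) := by
  have hconv : Convex ℝ {y : ℂ | 0 < y.re} := convex_halfSpace_re_gt 0
  have hopen : IsOpen {y : ℂ | 0 < y.re} := isOpen_lt continuous_const Complex.continuous_re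
  obtain ⟨P, hP⟩ := hconv.exists_forall_hasDerivWithinAt hf
  have hP' : ∀ y : ℂ, 0 < y.re → HasDerivAt P (f y) y := fun y hy =>
    (hP y hy).hasDerivAt (hopen.mem_nhds hy)
  have hre : ∀ (t τ : ℝ), ((t : ℂ) * (1 + τ * Complex.I)).re = t := by intro t τ; simp
  have hder : ∀ (τ t : ℝ), 0 < t → HasDerivAt (fun t : ℝ => P (t * (1 + τ * Complex.I)))
      ((1 + τ * Complex.I) * f (t * (1 + τ * Complex.I))) t := by
    intro τ t ht
    have h1 := hP' (t * (1 + τ * Complex.I)) (by rw [hre]; exact ht)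
    have h2 : HasDerivAt (fun t : ℝ => (t : ℂ) * (1 + τ * Complex.I))
        (1 * (1 + τ * Complex.I)) t := (Complex.ofRealCLM.hasDerivAt).mul_const _
    exact (h1.comp t h2).congr_deriv (by ring)
  have hint : ∀ τ ∈ uIcc τ₀ τ₁, IntegrableOn
      (fun t : ℝ => (1 + τ * Complex.I) * f (t * (1 + τ * Complex.I))) (Ioi 0) := by
    intro τ hτ
    refine Integrable.const_mul (Integrable.mono' hi ?_ ?_) _
    · refine ContinuousOn.aestronglyMeasurable ?_ measurableSet_Ioi
      refine hf.continuousOn.comp (by fun_prop) ?_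
      intro t ht; simpa [hre] using ht
    · exact (ae_restrict_iff' measurableSet_Ioi).2 (Eventually.of_forall fun t ht => hb t ht τ hτ)
  -- The points at parameter `t` on the two rays are joined by a vertical segment of length `|τ₁ -
  -- τ₀| t`, on which `‖f‖ ≤ b t`.
  have hdiff : ∀ t : ℝ, 0 < t →
      ‖P (t * (1 + τ₁ * Complex.I)) - P (t * (1 + τ₀ * Complex.I))‖ ≤ |τ₁ - τ₀| * (t * b t) := by
    intro t ht
    have hd : ∀ τ : ℝ, HasDerivAt (fun τ : ℝ => P (t * (1 + τ * Complex.I)))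
        (t * Complex.I * f (t * (1 + τ * Complex.I))) τ := by
      intro τ
      have h1 := hP' (t * (1 + τ * Complex.I)) (by rw [hre]; exact ht)
      have h2 : HasDerivAt (fun τ : ℝ => (t : ℂ) * (1 + τ * Complex.I))
          (t * (1 * Complex.I)) τ :=
        (((Complex.ofRealCLM.hasDerivAt).mul_const Complex.I).const_add 1).const_mul _
      exact (h1.comp τ h2).congr_deriv (by ring)
    have := (convex_uIcc τ₀ τ₁).norm_image_sub_le_of_norm_hasDerivWithin_le (C := t * b t)
      (fun τ _ => (hd τ).hasDerivWithinAt) (fun τ hτ => by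
        rw [norm_mul, norm_mul, Complex.norm_I, mul_one, Complex.norm_real, Real.norm_eq_abs,
          abs_of_pos ht]
        exact mul_le_mul_of_nonneg_left (hb t ht τ hτ) ht.le) left_mem_uIcc right_mem_uIcc
    rwa [Real.norm_eq_abs, mul_comm (t * b t)] at this
  set F : ℝ → ℂ := fun t => (1 + τ₁ * Complex.I) * f (t * (1 + τ₁ * Complex.I)) -
    (1 + τ₀ * Complex.I) * f (t * (1 + τ₀ * Complex.I)) with hF
  -- The primitive itself is not controlled at `0`, but this difference tends to `0` at both ends.
  -- Giving it the value `0` at the origin makes the fundamental theorem on `Ioi 0` applicable.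
  set Q : ℝ → ℂ := fun t => P (t * (1 + τ₁ * Complex.I)) - P (t * (1 + τ₀ * Complex.I)) with hQ
  have hQd : ∀ t ∈ Ioi (0 : ℝ), HasDerivAt Q (F t) t := fun t ht =>
    (hder τ₁ t ht).sub (hder τ₀ t ht)
  have hF' : IntegrableOn F (Ioi 0) := (hint τ₁ right_mem_uIcc).sub (hint τ₀ left_mem_uIcc)
  have hQ0 : Tendsto Q (𝓝[>] 0) (𝓝 0) := by
    refine squeeze_zero_norm' (a := fun t => |τ₁ - τ₀| * (t * b t)) ?_ (by simpa using hb0.const_mul _)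
    filter_upwards [self_mem_nhdsWithin] with t ht using hdiff t ht
  have hQ1 : Tendsto Q atTop (𝓝 0) := by
    refine squeeze_zero_norm' (a := fun t => |τ₁ - τ₀| * (t * b t)) ?_ (by simpa using hb1.const_mul _)
    filter_upwards [eventually_gt_atTop 0] with t ht using hdiff t ht
  have := integral_Ioi_of_hasDerivAt_of_tendsto (f := Function.update Q 0 0) (f' := F) (a := 0)
    (m := 0) ?_ ?_ hF' ?_
  · rw [integral_sub (hint τ₁ right_mem_uIcc) (hint τ₀ left_mem_uIcc)] at this
    simp only [Function.update_self, sub_zero] at this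
    exact (sub_eq_zero.1 this).symm
  · rw [continuousWithinAt_update_same]
    rwa [Ici_sdiff_left]
  · intro t ht
    refine (hQd t ht).congr_of_eventuallyEq ?_
    filter_upwards [lt_mem_nhds (show (0 : ℝ) < t from ht)] with s hs
    rw [Function.update_of_ne hs.ne']
  · refine hQ1.congr' ?_
    filter_upwards [eventually_gt_atTop 0] with s hs
    rw [Function.update_of_ne hs.ne']

/-- Truncated integrals of a holomorphic function along two horizontal lines differ by a null
sequence if the function tends to zero at both ends of the strip between them. -/
theorem tendsto_integral_horizontal_sub {f : ℂ → ℂ} {U : Set ℂ} {r₀ r₁ : ℝ} {b : ℝ → ℝ}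
    (hU : Convex ℝ U) (hUo : IsOpen U) (hf : DifferentiableOn ℂ f U)
    (hmem : ∀ u : ℝ, ∀ r ∈ uIcc r₀ r₁, (u + r * Complex.I : ℂ) ∈ U)
    (hb : ∀ᶠ T : ℝ in atTop, ∀ r ∈ uIcc r₀ r₁, ‖f ((T : ℝ) + r * Complex.I)‖ ≤ b T ∧
      ‖f (-T + r * Complex.I)‖ ≤ b T)
    (hb0 : Tendsto b atTop (𝓝 0)) :
    Tendsto (fun T : ℝ => (∫ u in -T..T, f (u + r₀ * Complex.I)) -
      ∫ u in -T..T, f (u + r₁ * Complex.I)) atTop (𝓝 0) := by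
  obtain ⟨P, hP⟩ := hU.exists_forall_hasDerivWithinAt hf
  have hP' : ∀ y ∈ U, HasDerivAt P (f y) y := fun y hy => (hP y hy).hasDerivAt (hUo.mem_nhds hy)
  have hh : ∀ r ∈ uIcc r₀ r₁, ∀ u : ℝ, HasDerivAt (fun u : ℝ => P (u + r * Complex.I))
      (f (u + r * Complex.I)) u := by
    intro r hr u
    have h2 : HasDerivAt (fun u : ℝ => (u : ℂ) + r * Complex.I) 1 u :=
      (Complex.ofRealCLM.hasDerivAt).add_const _
    exact ((hP' _ (hmem u r hr)).comp u h2).congr_deriv (by ring)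
  have hv : ∀ u : ℝ, ∀ r ∈ uIcc r₀ r₁, HasDerivAt (fun r : ℝ => P (u + r * Complex.I))
      (f (u + r * Complex.I) * Complex.I) r := by
    intro u r hr
    have h2 : HasDerivAt (fun r : ℝ => (u : ℂ) + r * Complex.I) (1 * Complex.I) r :=
      ((Complex.ofRealCLM.hasDerivAt).mul_const Complex.I).const_add _
    rw [one_mul] at h2
    exact (hP' _ (hmem u r hr)).comp r h2
  have hint : ∀ r ∈ uIcc r₀ r₁, ∀ T : ℝ, ∫ u in -T..T, f (u + r * Complex.I) =
      P (T + r * Complex.I) - P (-T + r * Complex.I) := by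
    intro r hr T
    rw [intervalIntegral.integral_eq_sub_of_hasDerivAt (fun u _ => hh r hr u)]
    · simp
    · refine ContinuousOn.intervalIntegrable (hf.continuousOn.comp (by fun_prop) ?_)
      intro u _; exact hmem u r hr
  have hvb : ∀ u c : ℝ, (∀ r ∈ uIcc r₀ r₁, ‖f (u + r * Complex.I)‖ ≤ c) →
      ‖P (u + r₁ * Complex.I) - P (u + r₀ * Complex.I)‖ ≤ c * |r₁ - r₀| := by
    intro u c hc
    exact (convex_uIcc r₀ r₁).norm_image_sub_le_of_norm_hasDerivWithin_le
      (fun r hr => (hv u r hr).hasDerivWithinAt) (fun r hr => by simpa using hc r hr)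
      left_mem_uIcc right_mem_uIcc
  refine squeeze_zero_norm' (a := fun T => 2 * (b T * |r₁ - r₀|)) ?_
    (by simpa using (hb0.mul_const |r₁ - r₀|).const_mul 2)
  filter_upwards [hb] with T hT
  rw [hint r₀ left_mem_uIcc, hint r₁ right_mem_uIcc]
  have h1 := hvb T (b T) (fun r hr => (hT r hr).1)
  have h2 := hvb (-T) (b T) (fun r hr => by simpa using (hT r hr).2)
  push_cast at h2
  calc _ = ‖(P (-T + r₁ * Complex.I) - P (-T + r₀ * Complex.I)) -
        (P (T + r₁ * Complex.I) - P (T + r₀ * Complex.I))‖ := by congr 1; ring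
    _ ≤ _ := (norm_sub_le _ _).trans (by linarith)

/-- A dominated integral of holomorphic functions is holomorphic. -/
theorem differentiableOn_integral_of_dominated {X : Type*} [MeasurableSpace X] {μ : Measure X}
    {F : ℂ → X → ℂ} {U : Set ℂ} (hU : IsOpen U) {b : X → ℝ} (hb : Integrable b μ)
    (hm : ∀ z ∈ U, AEStronglyMeasurable (F z) μ)
    (hF : ∀ᵐ t ∂μ, DifferentiableOn ℂ (F · t) U)
    (hle : ∀ᵐ t ∂μ, ∀ z ∈ U, ‖F z t‖ ≤ b t) :
    DifferentiableOn ℂ (fun z => ∫ t, F z t ∂μ) U := by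
  intro z₀ hz₀
  obtain ⟨ε, hε, hball⟩ := Metric.isOpen_iff.1 hU z₀ hz₀
  have hsub : ∀ z ∈ Metric.ball z₀ (ε / 2), ∀ x ∈ Metric.closedBall z (ε / 4), x ∈ U := by
    intro z hz x hx
    apply hball
    rw [Metric.mem_ball] at *
    rw [Metric.mem_closedBall] at hx
    linarith [dist_triangle x z z₀]
  have key := hasDerivAt_integral_of_dominated_loc_of_deriv_le (μ := μ) (F := F)
    (F' := fun z t => deriv (F · t) z) (x₀ := z₀) (s := Metric.ball z₀ (ε / 2))
    (bound := fun t => b t / (ε / 4)) (Metric.ball_mem_nhds _ (by positivity))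
    ?_ ?_ ?_ ?_ (hb.div_const _) ?_
  · exact key.2.differentiableAt.differentiableWithinAt
  · filter_upwards [hU.mem_nhds hz₀] with z hz using hm z hz
  · exact hb.mono' (hm z₀ hz₀) (hle.mono fun t ht => ht z₀ hz₀)
  -- Measurability of the derivative in `t`: it is a pointwise limit of difference quotients. The
  -- step `ε / (n + 2)` is nonzero and less than `ε` already for `n = 0`.
  · have hseq : ∀ n : ℕ, z₀ + ((ε / (n + 2) : ℝ) : ℂ) ∈ U := by
      intro n
      apply hball
      simp only [Metric.mem_ball, dist_self_add_left, Complex.norm_real, Real.norm_eq_abs]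
      rw [abs_of_pos (by positivity)]
      exact div_lt_self hε (by linarith [(Nat.cast_nonneg n : (0 : ℝ) ≤ n)])
    refine aestronglyMeasurable_of_tendsto_ae (u := (atTop : Filter ℕ)) (f := fun n t =>
      ((ε / (n + 2) : ℝ) : ℂ)⁻¹ * (F (z₀ + ((ε / (n + 2) : ℝ) : ℂ)) t - F z₀ t)) ?_ ?_
    · intro n
      exact ((hm _ (hseq n)).sub (hm z₀ hz₀)).const_mul _
    · filter_upwards [hF] with t ht
      have hd := ((ht z₀ hz₀).differentiableAt (hU.mem_nhds hz₀)).hasDerivAt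
      rw [hasDerivAt_iff_tendsto_slope_zero] at hd
      refine (Tendsto.comp (f := fun n : ℕ => ((ε / (n + 2) : ℝ) : ℂ)) (x := atTop) hd ?_).congr
        fun n => by simp
      rw [tendsto_nhdsWithin_iff]
      constructor
      · have h : Tendsto (fun n : ℕ => ε / ((n : ℝ) + 2)) atTop (𝓝 0) :=
          Tendsto.div_atTop tendsto_const_nhds
            (tendsto_atTop_add_const_right _ _ tendsto_natCast_atTop_atTop)
        exact (Complex.continuous_ofReal.tendsto 0).comp h
      · refine Eventually.of_forall fun n => ?_
        simp only [mem_compl_iff, mem_singleton_iff, Complex.ofReal_eq_zero]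
        positivity
  -- Cauchy's estimate on circles of radius `ε / 4` turns the bound on `F` into one on its
  -- derivative.
  · filter_upwards [hF, hle] with t ht hlt z hz
    refine Complex.norm_deriv_le_of_forall_mem_sphere_norm_le (by positivity) ?_ ?_
    · refine DifferentiableOn.diffContOnCl (s := Metric.ball z (ε / 4)) ?_
      rw [closure_ball _ (by positivity)]
      exact ht.mono (hsub z hz)
    · intro x hx
      exact hlt x (hsub z hz x (Metric.sphere_subset_closedBall hx))
  · filter_upwards [hF] with t ht z hz
    have hzU := hsub z hz z (Metric.mem_closedBall_self (by positivity))
    exact ((ht z hzU).differentiableAt (hU.mem_nhds hzU)).hasDerivAt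

/-! ### Taylor remainders -/

/-- An entire function that is `O(u ^ n)` at the origin is `u ^ n` times an entire function. -/
theorem exists_eq_pow_mul (n : ℕ) : ∀ {h : ℂ → ℂ}, Differentiable ℂ h →
    (∃ C : ℝ, ∀ᶠ u in 𝓝[≠] 0, ‖h u‖ ≤ C * ‖u‖ ^ n) →
    ∃ k : ℂ → ℂ, Differentiable ℂ k ∧ ∀ u, h u = u ^ n * k u := by
  induction n with
  | zero => intro h hd _; exact ⟨h, hd, by simp⟩
  | succ n ih =>
    rintro h hd ⟨C, hC⟩
    have h0 : h 0 = 0 := by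
      have h1 : Tendsto h (𝓝[≠] 0) (𝓝 (h 0)) := hd.continuous.continuousAt.continuousWithinAt
      have h2 : Tendsto h (𝓝[≠] 0) (𝓝 0) := by
        refine squeeze_zero_norm' hC ?_
        have : Tendsto (fun u : ℂ => C * ‖u‖ ^ (n + 1)) (𝓝 0) (𝓝 (C * ‖(0 : ℂ)‖ ^ (n + 1))) :=
          Continuous.tendsto (by fun_prop) 0
        simpa using this.mono_left nhdsWithin_le_nhds
      exact tendsto_nhds_unique h1 h2
    have hmul : ∀ u, h u = u * dslope h 0 u := by
      intro u
      have := sub_smul_dslope h 0 u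
      simpa [h0] using this.symm
    have hdd : Differentiable ℂ (dslope h 0) := by
      rw [← differentiableOn_univ]
      exact (Complex.differentiableOn_dslope univ_mem).2 hd.differentiableOn
    obtain ⟨k, hk, hk'⟩ := ih hdd ⟨C, by
      filter_upwards [hC, self_mem_nhdsWithin] with u hu hu0
      rw [hmul, norm_mul, pow_succ] at hu
      have : 0 < ‖u‖ := norm_pos_iff.2 hu0
      nlinarith⟩
    exact ⟨k, hk, fun u => by rw [hmul, hk', pow_succ]; ring⟩

/-- An entire remainder factor, rather than a mere norm bound, allows removable singularities to be
divided out explicitly in the Laurent expansion of the kernel. -/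
theorem exists_exp_eq (n : ℕ) : ∃ k : ℂ → ℂ, Differentiable ℂ k ∧
    ∀ u, Complex.exp u = ∑ m ∈ Finset.range n, u ^ m / m.factorial + u ^ n * k u := by
  obtain ⟨k, hk, h⟩ := exists_eq_pow_mul n
    (h := fun u => Complex.exp u - ∑ m ∈ Finset.range n, u ^ m / m.factorial)
    (by fun_prop) ⟨Real.exp 1, by
      filter_upwards [nhdsWithin_le_nhds (Metric.ball_mem_nhds (0 : ℂ) one_pos)] with u hu
      refine (Complex.norm_exp_sub_sum_le_norm_mul_exp u n).trans ?_
      rw [mul_comm]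
      gcongr
      simpa using (Metric.mem_ball.1 hu).le⟩
  exact ⟨k, hk, fun u => by rw [← h u]; ring⟩

theorem exists_sinh_eq : ∃ k : ℂ → ℂ, Differentiable ℂ k ∧
    ∀ u, Complex.sinh u = u + u ^ 3 / 6 + u ^ 5 * k u := by
  obtain ⟨k, hk, h⟩ := exists_exp_eq 5
  refine ⟨fun u => (k u + k (-u)) / 2, by fun_prop, fun u => ?_⟩
  rw [Complex.sinh, h u, h (-u)]
  simp [Finset.sum_range_succ, Nat.factorial]
  ring

/-! ### Truncated integrals of inverse powers -/

theorem tendsto_integral_inv {c : ℝ} (hc : 0 < c) :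
    Tendsto (fun T : ℝ => ∫ u in -T..T, ((u : ℂ) + c * Complex.I)⁻¹) atTop
      (𝓝 (-Real.pi * Complex.I)) := by
  have hne : ∀ u : ℝ, (u : ℂ) + c * Complex.I ≠ 0 := fun u h => by
    simpa [hc.ne'] using congrArg Complex.im h
  -- A branch of `log (u + c i)` up to a constant, written with real functions. Its logarithmic part
  -- is even and drops out over `[-T, T]`.
  have hd : ∀ u : ℝ, HasDerivAt (fun u : ℝ => ((Real.log (u ^ 2 + c ^ 2) / 2 : ℝ) : ℂ) -
      Complex.I * (Real.arctan (u / c) : ℝ)) (((u : ℂ) + c * Complex.I)⁻¹) u := by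
    intro u
    have hp : u ^ 2 + c ^ 2 ≠ 0 := by positivity
    have h1 : HasDerivAt (fun u : ℝ => Real.log (u ^ 2 + c ^ 2) / 2) (u / (u ^ 2 + c ^ 2)) u := by
      have := ((((hasDerivAt_id u).pow 2).add_const (c ^ 2)).log hp).div_const 2
      refine this.congr_deriv ?_
      simp; field_simp
    have h2 : HasDerivAt (fun u : ℝ => Real.arctan (u / c)) (c / (u ^ 2 + c ^ 2)) u := by
      have := ((hasDerivAt_id u).div_const c).arctan
      refine this.congr_deriv ?_
      simp; field_simp; ring
    refine (h1.ofReal_comp.sub (h2.ofReal_comp.const_mul Complex.I)).congr_deriv ?_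
    have hp' : (u : ℂ) ^ 2 + (c : ℂ) ^ 2 ≠ 0 := by exact_mod_cast hp
    push_cast
    have h3 := hne u
    field_simp
    linear_combination (-(c:ℂ)^2) * Complex.I_sq
  have hI : ∀ T : ℝ, ∫ u in -T..T, ((u : ℂ) + c * Complex.I)⁻¹ =
      -2 * Complex.I * (Real.arctan (T / c) : ℝ) := by
    intro T
    rw [intervalIntegral.integral_eq_sub_of_hasDerivAt (fun u _ => hd u)]
    · rw [neg_div, Real.arctan_neg, neg_sq]; push_cast; ring
    · exact (Continuous.inv₀ (by fun_prop) hne).intervalIntegrable _ _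
  simp_rw [hI]
  have h3 : Tendsto (fun T : ℝ => Real.arctan (T / c)) atTop (𝓝 (Real.pi / 2)) :=
    (Real.tendsto_arctan_atTop.mono_right nhdsWithin_le_nhds).comp
      (tendsto_id.atTop_div_const hc)
  have h4 := ((Complex.continuous_ofReal.tendsto _).comp h3).const_mul (-2 * Complex.I)
  rw [show -Real.pi * Complex.I = -2 * Complex.I * ((Real.pi / 2 : ℝ) : ℂ) by push_cast; ring]
  exact h4

theorem tendsto_integral_inv_of_neg {c : ℝ} (hc : c < 0) :
    Tendsto (fun T : ℝ => ∫ u in -T..T, ((u : ℂ) + c * Complex.I)⁻¹) atTop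
      (𝓝 (Real.pi * Complex.I)) := by
  have h := (tendsto_integral_inv (neg_pos.2 hc)).neg
  rw [neg_mul, neg_neg] at h
  refine h.congr fun T => ?_
  have e := intervalIntegral.integral_comp_neg (a := -T) (b := T)
    (fun u : ℝ => ((u : ℂ) + c * Complex.I)⁻¹)
  rw [neg_neg] at e
  rw [← intervalIntegral.integral_neg, ← e]
  refine intervalIntegral.integral_congr fun u _ => ?_
  rw [← inv_neg]
  push_cast
  congr 1; ring

theorem tendsto_integral_inv_pow {c : ℝ} (hc : c ≠ 0) {n : ℕ} (hn : n ≠ 0) :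
    Tendsto (fun T : ℝ => ∫ u in -T..T, (((u : ℂ) + c * Complex.I) ^ (n + 1))⁻¹) atTop
      (𝓝 0) := by
  have hne : ∀ u : ℝ, (u : ℂ) + c * Complex.I ≠ 0 := fun u h => by
    simpa [hc] using congrArg Complex.im h
  have hn' : (n : ℂ) ≠ 0 := Nat.cast_ne_zero.2 hn
  have hd : ∀ u : ℝ, HasDerivAt (fun u : ℝ => -(((u : ℂ) + c * Complex.I) ^ n)⁻¹ / n)
      ((((u : ℂ) + c * Complex.I) ^ (n + 1))⁻¹) u := by
    intro u
    have h1 : HasDerivAt (fun u : ℝ => (u : ℂ) + c * Complex.I) 1 u :=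
      (Complex.ofRealCLM.hasDerivAt).add_const _
    refine (((h1.pow n).inv (pow_ne_zero _ (hne u))).neg.div_const (n : ℂ)).congr_deriv ?_
    have h2 := hne u
    obtain ⟨m, rfl⟩ := Nat.exists_eq_succ_of_ne_zero hn
    simp only [Nat.succ_eq_add_one, Nat.add_sub_cancel, Pi.pow_apply] at *
    field_simp
    ring
  have hI : ∀ T : ℝ, ∫ u in -T..T, (((u : ℂ) + c * Complex.I) ^ (n + 1))⁻¹ =
      -(((T : ℂ) + c * Complex.I) ^ n)⁻¹ / n - -((((-T : ℝ) : ℂ) + c * Complex.I) ^ n)⁻¹ / n := by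
    intro T
    rw [intervalIntegral.integral_eq_sub_of_hasDerivAt (fun u _ => hd u)]
    exact (Continuous.inv₀ (by fun_prop) fun u => pow_ne_zero _ (hne u)).intervalIntegrable _ _
  simp_rw [hI]
  have h0 : ∀ s : ℝ → ℝ, Tendsto (fun T => |s T|) atTop atTop →
      Tendsto (fun T : ℝ => -(((s T : ℂ) + c * Complex.I) ^ n)⁻¹ / n) atTop (𝓝 0) := by
    intro s hs
    have h1 : Tendsto (fun T : ℝ => ‖((s T : ℂ) + c * Complex.I)‖) atTop atTop := by
      refine tendsto_atTop_mono (fun T => ?_) hs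
      simpa using Complex.abs_re_le_norm ((s T : ℂ) + c * Complex.I)
    have h2 := tendsto_inv_atTop_zero.comp ((tendsto_pow_atTop hn).comp h1)
    rw [tendsto_zero_iff_norm_tendsto_zero]
    have := h2.div_const (n : ℝ)
    rw [zero_div] at this
    refine this.congr fun T => ?_
    simp
  simpa using (h0 (fun T => T) tendsto_abs_atTop_atTop).sub
    (h0 (fun T => -T) (by simpa using tendsto_abs_atTop_atTop))

/-! ### The holomorphic continuation of the integral -/

/-- Merges a bound near the origin and a bound at infinity into a single integrable majorant. -/
theorem le_mul_inv_one_add_sq {t x C₁ C₂ : ℝ} (ht : 0 < t) (h₁ : 0 ≤ C₁) (h₂ : 0 ≤ C₂)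
    (hx₁ : t ≤ 1 → x ≤ C₁) (hx₂ : 1 ≤ t → x ≤ C₂ / t ^ 2) :
    x ≤ 2 * (C₁ + C₂) * (1 + t ^ 2)⁻¹ := by
  rw [← div_eq_mul_inv]
  rcases le_total t 1 with h | h
  · refine (hx₁ h).trans ?_
    rw [le_div_iff₀ (by positivity)]
    have : t ^ 2 ≤ 1 := by nlinarith
    nlinarith
  · refine (hx₂ h).trans ?_
    rw [div_le_div_iff₀ (by positivity) (by positivity)]
    have : 1 ≤ t ^ 2 := by nlinarith
    nlinarith [mul_nonneg h₁ (sq_nonneg t), mul_nonneg h₂ (sub_nonneg.2 this)]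

theorem integrableOn_mul_inv_one_add_sq (C : ℝ) :
    IntegrableOn (fun t : ℝ => C * (1 + t ^ 2)⁻¹) (Ioi 0) :=
  (integrable_inv_one_add_sq.const_mul C).integrableOn

theorem integral_ray_eq_of_le {f : ℂ → ℂ} {τ₀ τ₁ C : ℝ}
    (hf : DifferentiableOn ℂ f {y | 0 < y.re})
    (hb : ∀ t : ℝ, 0 < t → ∀ τ ∈ uIcc τ₀ τ₁,
      ‖f (t * (1 + τ * Complex.I))‖ ≤ C * (1 + t ^ 2)⁻¹) :
    ∫ t in Ioi (0 : ℝ), (1 + τ₀ * Complex.I) * f (t * (1 + τ₀ * Complex.I)) =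
      ∫ t in Ioi (0 : ℝ), (1 + τ₁ * Complex.I) * f (t * (1 + τ₁ * Complex.I)) := by
  refine integral_ray_eq hf hb ?_ ?_ (integrableOn_mul_inv_one_add_sq C)
  · have : Tendsto (fun t : ℝ => t * (C * (1 + t ^ 2)⁻¹)) (𝓝 0)
        (𝓝 (0 * (C * (1 + (0 : ℝ) ^ 2)⁻¹))) :=
      Continuous.tendsto (continuous_id.mul (continuous_const.mul
        (Continuous.inv₀ (by fun_prop) fun t => by positivity))) 0
    rw [zero_mul] at this
    exact this.mono_left nhdsWithin_le_nhds
  · have h : Tendsto (fun t : ℝ => |C| * t⁻¹) atTop (𝓝 0) := by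
      simpa using tendsto_inv_atTop_zero.const_mul |C|
    refine squeeze_zero_norm' ?_ h
    filter_upwards [eventually_gt_atTop 0] with t ht
    rw [norm_mul, norm_mul, Real.norm_eq_abs, Real.norm_eq_abs, abs_of_pos ht,
      Real.norm_of_nonneg (by positivity : (0 : ℝ) ≤ (1 + t ^ 2)⁻¹), mul_left_comm]
    refine mul_le_mul_of_nonneg_left ?_ (abs_nonneg C)
    rw [← div_eq_mul_inv, div_le_iff₀ (by positivity), inv_mul_eq_div, le_div_iff₀ ht]
    nlinarith

/-- The integrand of `gIntegral`, as a function of a complex integration variable. -/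
noncomputable def gIntegrand (ap am : ℝ) (z y : ℂ) : ℂ :=
  (1 / y) * (Complex.sin (2 * y * z) / (2 * Complex.sinh (ap * y) * Complex.sinh (am * y))
      - z / (ap * am * y))

theorem gIntegrand_neg (ap am : ℝ) (z y : ℂ) :
    gIntegrand ap am (-z) y = -gIntegrand ap am z y := by
  simp only [gIntegrand, mul_neg, Complex.sin_neg]; ring

theorem sinh_mul_ne_zero {c : ℝ} (hc : 0 < c) {y : ℂ} (hy : 0 < y.re) :
    Complex.sinh (c * y) ≠ 0 :=
  sinh_ne_zero_of_re (by simp [hc.ne', hy.ne'])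

theorem mul_re_le_norm_sinh {c : ℝ} (hc : 0 < c) (y : ℂ) :
    c * |y.re| ≤ ‖Complex.sinh (c * y)‖ := by
  simpa [abs_mul, abs_of_pos hc] using abs_re_le_norm_sinh (c * y)

/-- Over the common denominator, the numerator is made of Taylor remainders and is of order `y ^ 4`,
like the denominator. This shows boundedness at the origin. -/
theorem gIntegrand_eq {ap am : ℝ} (hap : 0 < ap) (ham : 0 < am) (z : ℂ) {y : ℂ}
    (hy : 0 < y.re) : gIntegrand ap am z y =
      (ap * am * y * (Complex.sin (2 * y * z) - 2 * y * z) - 2 * z *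
        ((Complex.sinh (ap * y) - ap * y) * Complex.sinh (am * y) +
          ap * y * (Complex.sinh (am * y) - am * y))) /
      (2 * ap * am * y ^ 2 * Complex.sinh (ap * y) * Complex.sinh (am * y)) := by
  have h1 := sinh_mul_ne_zero hap hy
  have h2 := sinh_mul_ne_zero ham hy
  have h3 : y ≠ 0 := fun h => by simp [h] at hy
  have h4 : (ap : ℂ) ≠ 0 := by exact_mod_cast hap.ne'
  have h5 : (am : ℂ) ≠ 0 := by exact_mod_cast ham.ne'
  rw [gIntegrand]
  generalize Complex.sinh (ap * y) = a at *
  generalize Complex.sinh (am * y) = b at *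
  field_simp
  ring

theorem differentiableOn_gIntegrand {ap am : ℝ} (hap : 0 < ap) (ham : 0 < am) (z : ℂ) :
    DifferentiableOn ℂ (gIntegrand ap am z) {y | 0 < y.re} := by
  intro y hy
  have h1 := sinh_mul_ne_zero hap hy
  have h2 := sinh_mul_ne_zero ham hy
  have h3 : y ≠ 0 := fun h => by simp [h] at hy
  have h4 : (ap : ℂ) ≠ 0 := by exact_mod_cast hap.ne'
  have h5 : (am : ℂ) ≠ 0 := by exact_mod_cast ham.ne'
  have h6 : 2 * Complex.sinh (ap * y) * Complex.sinh (am * y) ≠ 0 := by simp [h1, h2]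
  have h7 : (ap * am * y : ℂ) ≠ 0 := by simp [h3, h4, h5]
  unfold gIntegrand
  apply DifferentiableAt.differentiableWithinAt
  fun_prop (disch := assumption)

theorem differentiable_gIntegrand (ap am : ℝ) (y : ℂ) :
    Differentiable ℂ (fun z => gIntegrand ap am z y) := by
  unfold gIntegrand
  fun_prop

theorem norm_gIntegrand_le_of_le_one {ap am Z W : ℝ} (hap : 0 < ap) (ham : 0 < am) (hZ : 0 ≤ Z) :
    ∃ C : ℝ, 0 ≤ C ∧ ∀ (z w : ℂ) (t : ℝ), ‖z‖ ≤ Z → w.re = 1 → ‖w‖ ≤ W → 0 < t → t ≤ 1 →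
      ‖gIntegrand ap am z (t * w)‖ ≤ C := by
  set K : ℝ := ap * am * (8 * Z ^ 3 * Real.exp (2 * W * Z)) + 2 * Z *
    (ap ^ 3 * am * (Real.exp (ap * W) * Real.exp (am * W)) +
      ap * am ^ 3 * Real.exp (am * W)) with hK
  have hK0 : 0 ≤ K := by positivity
  refine ⟨K * W ^ 2 / (2 * ap ^ 2 * am ^ 2), by positivity, ?_⟩
  intro z w t hz hw hwW ht ht1
  set y : ℂ := t * w with hy
  have hyre : y.re = t := by simp [hy, hw]
  have hyn : ‖y‖ = t * ‖w‖ := by simp [hy, abs_of_pos ht]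
  have hyW : ‖y‖ ≤ W := by
    rw [hyn]; nlinarith [norm_nonneg w]
  have hypos : 0 < ‖y‖ := norm_pos_iff.2 fun h => by rw [h] at hyre; simp at hyre; linarith
  have hnA : ‖(ap * y : ℂ)‖ = ap * ‖y‖ := by simp [abs_of_pos hap]
  have hnB : ‖(am * y : ℂ)‖ = am * ‖y‖ := by simp [abs_of_pos ham]
  have hsin : ‖Complex.sin (2 * y * z) - 2 * y * z‖ ≤
      ‖y‖ ^ 3 * (8 * Z ^ 3 * Real.exp (2 * W * Z)) := by
    refine (norm_sin_sub_le _).trans ?_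
    have : ‖2 * y * z‖ = 2 * ‖y‖ * ‖z‖ := by simp
    rw [this, show ‖y‖ ^ 3 * (8 * Z ^ 3 * Real.exp (2 * W * Z)) =
      (2 * ‖y‖ * Z) ^ 3 * Real.exp (2 * W * Z) by ring]
    have hW : 0 ≤ W := hypos.le.trans hyW
    gcongr
  have hA : ‖Complex.sinh (ap * y) - ap * y‖ ≤ ‖y‖ ^ 3 * (ap ^ 3 * Real.exp (ap * W)) := by
    refine (norm_sinh_sub_le _).trans ?_
    rw [hnA, show ‖y‖ ^ 3 * (ap ^ 3 * Real.exp (ap * W)) = (ap * ‖y‖) ^ 3 * Real.exp (ap * W)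
      by ring]
    gcongr
  have hB : ‖Complex.sinh (am * y) - am * y‖ ≤ ‖y‖ ^ 3 * (am ^ 3 * Real.exp (am * W)) := by
    refine (norm_sinh_sub_le _).trans ?_
    rw [hnB, show ‖y‖ ^ 3 * (am ^ 3 * Real.exp (am * W)) = (am * ‖y‖) ^ 3 * Real.exp (am * W)
      by ring]
    gcongr
  have hB' : ‖Complex.sinh (am * y)‖ ≤ ‖y‖ * (am * Real.exp (am * W)) := by
    refine (norm_sinh_le _).trans ?_
    rw [hnB, show ‖y‖ * (am * Real.exp (am * W)) = (am * ‖y‖) * Real.exp (am * W) by ring]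
    gcongr
  have hlA : ap * t ≤ ‖Complex.sinh (ap * y)‖ := by
    simpa [hyre, abs_of_pos ht] using mul_re_le_norm_sinh hap y
  have hlB : am * t ≤ ‖Complex.sinh (am * y)‖ := by
    simpa [hyre, abs_of_pos ht] using mul_re_le_norm_sinh ham y
  rw [gIntegrand_eq hap ham z (by rw [hyre]; exact ht), norm_div]
  have hnum : ‖ap * am * y * (Complex.sin (2 * y * z) - 2 * y * z) - 2 * z *
        ((Complex.sinh (ap * y) - ap * y) * Complex.sinh (am * y) +
          ap * y * (Complex.sinh (am * y) - am * y))‖ ≤ ‖y‖ ^ 4 * K := by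
    refine (norm_sub_le _ _).trans ?_
    have e1 : ‖ap * am * y * (Complex.sin (2 * y * z) - 2 * y * z)‖ ≤
        ap * am * ‖y‖ * (‖y‖ ^ 3 * (8 * Z ^ 3 * Real.exp (2 * W * Z))) := by
      rw [norm_mul, norm_mul, norm_mul, Complex.norm_real, Complex.norm_real,
        Real.norm_of_nonneg hap.le, Real.norm_of_nonneg ham.le]
      gcongr
    have e2 : ‖(Complex.sinh (ap * y) - ap * y) * Complex.sinh (am * y) +
          ap * y * (Complex.sinh (am * y) - am * y)‖ ≤
        ‖y‖ ^ 3 * (ap ^ 3 * Real.exp (ap * W)) * (‖y‖ * (am * Real.exp (am * W))) +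
          ap * ‖y‖ * (‖y‖ ^ 3 * (am ^ 3 * Real.exp (am * W))) := by
      refine (norm_add_le _ _).trans ?_
      rw [norm_mul, norm_mul (ap * y : ℂ), hnA]
      gcongr
    rw [norm_mul (2 * z), norm_mul 2 z, Complex.norm_ofNat]
    calc _ ≤ ap * am * ‖y‖ * (‖y‖ ^ 3 * (8 * Z ^ 3 * Real.exp (2 * W * Z))) + 2 * Z *
          (‖y‖ ^ 3 * (ap ^ 3 * Real.exp (ap * W)) * (‖y‖ * (am * Real.exp (am * W))) +
          ap * ‖y‖ * (‖y‖ ^ 3 * (am ^ 3 * Real.exp (am * W)))) := by gcongr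
      _ = _ := by rw [hK]; ring
  have hden : 2 * ap * am * ‖y‖ ^ 2 * (ap * t) * (am * t) ≤
      ‖2 * ap * am * y ^ 2 * Complex.sinh (ap * y) * Complex.sinh (am * y)‖ := by
    simp only [norm_mul, norm_pow, Complex.norm_real, Real.norm_of_nonneg hap.le,
      Real.norm_of_nonneg ham.le, Complex.norm_ofNat]
    gcongr
  calc _ ≤ ‖y‖ ^ 4 * K / (2 * ap * am * ‖y‖ ^ 2 * (ap * t) * (am * t)) := by gcongr
    _ = K * ‖w‖ ^ 2 / (2 * ap ^ 2 * am ^ 2) := by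
      have : ‖w‖ ≠ 0 := fun h => by rw [hyn, h] at hypos; simp at hypos
      rw [hyn]; field_simp
    _ ≤ _ := by gcongr

theorem exp_mul_le_sinh {c t : ℝ} (hc : 0 ≤ c) (ht : 1 ≤ t) :
    Real.exp (c * t) * ((1 - Real.exp (-2 * c)) / 2) ≤ Real.sinh (c * t) := by
  rw [Real.sinh_eq]
  have h : Real.exp (-(c * t)) = Real.exp (c * t) * Real.exp (-2 * (c * t)) := by
    rw [← Real.exp_add]; ring_nf
  rw [h]
  have h2 : Real.exp (-2 * (c * t)) ≤ Real.exp (-2 * c) := by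
    apply Real.exp_le_exp.2; nlinarith
  nlinarith [Real.exp_pos (c * t)]

/-- For `t ≥ 1` the sine is at most `exp (2 t (a - η))`, while the two `sinh` factors have product
at least a constant times `exp (2 t a)`. The gain `exp (-2 η t) ≤ 1 / (2 η t)` and the prefactor `1
/ y` give decay `t⁻²`. -/
theorem norm_gIntegrand_le {ap am Z W η : ℝ} (hap : 0 < ap) (ham : 0 < am) (hZ : 0 ≤ Z)
    (hη : 0 < η) : ∃ C : ℝ, ∀ (z w : ℂ) (t : ℝ), ‖z‖ ≤ Z → w.re = 1 → ‖w‖ ≤ W →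
      |(w * z).im| ≤ (ap + am) / 2 - η → 0 < t →
      ‖gIntegrand ap am z (t * w)‖ ≤ C * (1 + t ^ 2)⁻¹ := by
  obtain ⟨C₁, hC₁, h₁⟩ := norm_gIntegrand_le_of_le_one (W := W) hap ham hZ
  have hpos : ∀ c : ℝ, 0 < c → 0 < (1 - Real.exp (-2 * c)) / 2 := fun c hc => by
    have : Real.exp (-2 * c) < 1 := by
      rw [← Real.exp_zero]; exact Real.exp_lt_exp.2 (by linarith)
    linarith
  set p := (1 - Real.exp (-2 * ap)) / 2 with hp
  set q := (1 - Real.exp (-2 * am)) / 2 with hq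
  have hp0 : 0 < p := hpos ap hap
  have hq0 : 0 < q := hpos am ham
  refine ⟨2 * (C₁ + (1 / (4 * η * p * q) + Z / (ap * am))), fun z w t hz hw hwW him ht =>
    le_mul_inv_one_add_sq ht hC₁ (by positivity) (h₁ z w t hz hw hwW ht) fun ht1 => ?_⟩
  set y : ℂ := t * w with hy
  have hyre : y.re = t := by simp [hy, hw]
  have hyt : t ≤ ‖y‖ := by simpa [hyre, abs_of_pos ht] using Complex.abs_re_le_norm y
  have hypos : 0 < ‖y‖ := ht.trans_le hyt
  have hs : ∀ c : ℝ, 0 < c → Real.exp (c * t) * ((1 - Real.exp (-2 * c)) / 2) ≤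
      ‖Complex.sinh (c * y)‖ := by
    intro c hc
    refine (exp_mul_le_sinh hc.le ht1).trans ?_
    have := abs_sinh_re_le (c * y)
    simp only [Complex.re_ofReal_mul, hyre] at this
    exact (le_abs_self _).trans this
  have hA := hs ap hap
  have hB := hs am ham
  have hsin : ‖Complex.sin (2 * y * z)‖ ≤ Real.exp (2 * t * ((ap + am) / 2 - η)) := by
    refine (norm_sin_le _).trans (Real.exp_le_exp.2 ?_)
    have : (2 * y * z).im = 2 * t * (w * z).im := by
      rw [hy, show 2 * (t * w) * z = ((2 * t : ℝ) : ℂ) * (w * z) by push_cast; ring,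
        Complex.im_ofReal_mul]
    rw [this, abs_mul, abs_of_pos (by positivity)]
    gcongr
  have hE : Real.exp (2 * t * ((ap + am) / 2 - η)) =
      Real.exp (ap * t) * Real.exp (am * t) * Real.exp (-(2 * η * t)) := by
    rw [← Real.exp_add, ← Real.exp_add]; ring_nf
  have hη' : Real.exp (-(2 * η * t)) ≤ 1 / (2 * η * t) := by
    rw [Real.exp_neg, ← one_div]
    refine one_div_le_one_div_of_le (by positivity) ?_
    linarith [Real.add_one_le_exp (2 * η * t)]
  rw [gIntegrand, norm_mul, norm_div, norm_one]
  have e1 : ‖Complex.sin (2 * y * z) / (2 * Complex.sinh (ap * y) * Complex.sinh (am * y))‖ ≤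
      1 / (4 * η * p * q) / t := by
    rw [norm_div, norm_mul, norm_mul, Complex.norm_ofNat]
    calc _ ≤ Real.exp (ap * t) * Real.exp (am * t) * (1 / (2 * η * t)) /
          (2 * (Real.exp (ap * t) * p) * (Real.exp (am * t) * q)) := by
          have h3 : ‖Complex.sin (2 * y * z)‖ ≤
              Real.exp (ap * t) * Real.exp (am * t) * (1 / (2 * η * t)) := by
            refine hsin.trans ?_
            rw [hE]
            gcongr
          gcongr
      _ = _ := by field_simp; ring
  have e2 : ‖z / (ap * am * y)‖ ≤ Z / (ap * am) / t := by
    rw [norm_div, norm_mul, norm_mul, Complex.norm_real, Complex.norm_real,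
        Real.norm_of_nonneg hap.le, Real.norm_of_nonneg ham.le, div_div]
    gcongr
  calc _ ≤ 1 / t * (1 / (4 * η * p * q) / t + Z / (ap * am) / t) := by
        gcongr
        exact (norm_sub_le _ _).trans (add_le_add e1 e2)
    _ = _ := by field_simp

/-- The integral of `gIntegrand` along the ray from the origin through `1 + τ i`. -/
noncomputable def gRay (ap am τ : ℝ) (z : ℂ) : ℂ :=
  ∫ t in Ioi (0 : ℝ), (1 + τ * Complex.I) * gIntegrand ap am z (t * (1 + τ * Complex.I))

theorem gRay_zero (ap am : ℝ) : gRay ap am 0 = gIntegral ap am := by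
  funext z
  simp [gRay, gIntegral, gIntegrand]

theorem gRay_neg (ap am τ : ℝ) (z : ℂ) : gRay ap am τ (-z) = -gRay ap am τ z := by
  simp only [gRay, gIntegrand_neg, mul_neg, integral_neg]

theorem im_one_add_mul_I_mul (τ : ℝ) (z : ℂ) :
    ((1 + τ * Complex.I) * z).im = z.im + τ * z.re := by simp

/-- The function `τ ↦ |Im z + τ Re z|` is convex, so its bound at the two end slopes holds for every
ray in the sector between them. -/
theorem gRay_eq_gRay {ap am τ₀ τ₁ : ℝ} (hap : 0 < ap) (ham : 0 < am) {z : ℂ}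
    (h₀ : |z.im + τ₀ * z.re| < (ap + am) / 2) (h₁ : |z.im + τ₁ * z.re| < (ap + am) / 2) :
    gRay ap am τ₀ z = gRay ap am τ₁ z := by
  set m := max |z.im + τ₀ * z.re| |z.im + τ₁ * z.re| with hm
  have hm' : m < (ap + am) / 2 := max_lt h₀ h₁
  have hcv : ∀ τ ∈ uIcc τ₀ τ₁, |z.im + τ * z.re| ≤ m := by
    intro τ hτ
    have hc : ConvexOn ℝ univ (fun τ : ℝ => |z.im + τ * z.re|) := by
      have := (convexOn_norm (E := ℝ) convex_univ).comp_affineMap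
        (AffineMap.lineMap z.im (z.im + z.re))
      simpa [Function.comp_def, AffineMap.lineMap_apply, add_comm] using this
    exact hc.le_max_of_mem_segment (mem_univ _) (mem_univ _) (by rwa [segment_eq_uIcc])
  obtain ⟨C, hC⟩ := norm_gIntegrand_le (W := 1 + max |τ₀| |τ₁|) hap ham (norm_nonneg z)
    (sub_pos.2 hm')
  refine integral_ray_eq_of_le (C := C) (differentiableOn_gIntegrand hap ham z) ?_
  intro t ht τ hτ
  refine hC z _ t le_rfl (by simp) ?_ ?_ ht
  · refine (norm_add_le _ _).trans ?_
    have : |τ| ≤ max |τ₀| |τ₁| := by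
      rcases mem_uIcc.1 hτ with h | h
      · exact abs_le_max_abs_abs h.1 h.2
      · rw [max_comm]; exact abs_le_max_abs_abs h.1 h.2
    simpa using this
  · rw [im_one_add_mul_I_mul]
    linarith [hcv τ hτ]

theorem isOpen_tilted_strip (a τ : ℝ) : IsOpen {z : ℂ | |z.im + τ * z.re| < a} :=
  isOpen_lt (by fun_prop) continuous_const

theorem differentiableOn_gRay {ap am : ℝ} (hap : 0 < ap) (ham : 0 < am) (τ : ℝ) :
    DifferentiableOn ℂ (gRay ap am τ) {z | |z.im + τ * z.re| < (ap + am) / 2} := by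
  intro z₀ hz₀
  obtain ⟨c, hc, hca⟩ := exists_between (show |z₀.im + τ * z₀.re| < (ap + am) / 2 from hz₀)
  -- A narrower strip and a bounded region make the majorant uniform in `z`.
  set U : Set ℂ := {z | |z.im + τ * z.re| < c} ∩ Metric.ball 0 (‖z₀‖ + 1) with hU
  have hUo : IsOpen U := (isOpen_tilted_strip c τ).inter Metric.isOpen_ball
  have hz₀U : z₀ ∈ U := ⟨hc, by simp⟩
  obtain ⟨C, hC⟩ := norm_gIntegrand_le (W := ‖(1 + τ * Complex.I : ℂ)‖) hap ham
    (show 0 ≤ ‖z₀‖ + 1 by positivity) (sub_pos.2 hca)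
  have := differentiableOn_integral_of_dominated (μ := volume.restrict (Ioi (0 : ℝ)))
    (F := fun z t => (1 + τ * Complex.I) * gIntegrand ap am z (t * (1 + τ * Complex.I))) hUo
    ((integrableOn_mul_inv_one_add_sq C).const_mul ‖(1 + τ * Complex.I : ℂ)‖) ?_ ?_ ?_
  · exact ((this z₀ hz₀U).differentiableAt (hUo.mem_nhds hz₀U)).differentiableWithinAt
  · intro z _
    refine ContinuousOn.aestronglyMeasurable (ContinuousOn.mul continuousOn_const ?_)
      measurableSet_Ioi
    refine (differentiableOn_gIntegrand hap ham z).continuousOn.comp (by fun_prop) ?_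
    intro t ht; simpa using ht
  · exact Eventually.of_forall fun t =>
      ((differentiable_gIntegrand ap am _).const_mul _).differentiableOn
  · refine (ae_restrict_iff' measurableSet_Ioi).2 (Eventually.of_forall fun t ht z hz => ?_)
    rw [norm_mul]
    refine mul_le_mul_of_nonneg_left (hC z _ t ?_ (by simp) le_rfl ?_ ht) (norm_nonneg _)
    · simpa using (Metric.mem_ball.1 hz.2).le
    · rw [im_one_add_mul_I_mul]
      have : |z.im + τ * z.re| < c := hz.1
      linarith

theorem isOpen_cutPlane (ap am : ℝ) : IsOpen (cutPlane ap am) := by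
  have h : IsClosed {z : ℂ | z.re = 0 ∧ (ap + am) / 2 ≤ |z.im|} :=
    (isClosed_eq Complex.continuous_re continuous_const).inter
      (isClosed_le continuous_const Complex.continuous_im.abs)
  exact h.isOpen_compl

theorem exists_isContinuation {ap am : ℝ} (hap : 0 < ap) (ham : 0 < am) :
    ∃ f, IsContinuation ap am f := by
  -- The slope `-(Im z / Re z)` makes `(1 + τ i) z` real. On the imaginary axis division by zero
  -- gives `τ = 0`, the original ray, which suffices off the cuts.
  have hτ : ∀ z ∈ cutPlane ap am, |z.im + -(z.im / z.re) * z.re| < (ap + am) / 2 := by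
    intro z hz
    by_cases h : z.re = 0
    · have : ¬ (ap + am) / 2 ≤ |z.im| := fun h' => hz ⟨h, h'⟩
      simpa [h] using this
    · rw [neg_mul, div_mul_cancel₀ _ h, add_neg_cancel, abs_zero]; positivity
  have heq : ∀ τ : ℝ, ∀ z ∈ cutPlane ap am, |z.im + τ * z.re| < (ap + am) / 2 →
      gRay ap am (-(z.im / z.re)) z = gRay ap am τ z := fun τ z hz h =>
    gRay_eq_gRay hap ham (hτ z hz) h
  refine ⟨fun z => gRay ap am (-(z.im / z.re)) z, fun z₀ hz₀ => ?_, fun z hz => ?_⟩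
  · have hmem := hτ z₀ hz₀
    have hd := (differentiableOn_gRay hap ham (-(z₀.im / z₀.re))).differentiableAt
      ((isOpen_tilted_strip _ _).mem_nhds hmem)
    refine (hd.congr_of_eventuallyEq ?_).differentiableWithinAt
    filter_upwards [(isOpen_tilted_strip _ _).mem_nhds hmem, (isOpen_cutPlane ap am).mem_nhds hz₀]
      with z h1 h2 using heq _ z h2 h1
  · have hz' : |z.im| < (ap + am) / 2 := hz
    have hcut : z ∈ cutPlane ap am := fun h => absurd h.2 (not_le.2 hz')
    rw [← gRay_zero]
    exact heq 0 z hcut (by simpa using hz')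

theorem isContinuation_g {ap am : ℝ} (hap : 0 < ap) (ham : 0 < am) :
    IsContinuation ap am (g ap am) :=
  Classical.epsilon_spec (exists_isContinuation hap ham)

/-! ### The kernel of the contour integral representation -/

/-- The function `exp (2 i y z) / (y sinh (a₊ y) sinh (a₋ y))` of the integration variable `y`. -/
noncomputable def kernel (ap am : ℝ) (z y : ℂ) : ℂ :=
  Complex.exp (2 * Complex.I * y * z) / (y * Complex.sinh (ap * y) * Complex.sinh (am * y))

theorem norm_exp_two_I_mul (y z : ℂ) :
    ‖Complex.exp (2 * Complex.I * y * z)‖ = Real.exp (-2 * (y * z).im) := by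
  rw [Complex.norm_exp]
  congr 1
  rw [show 2 * Complex.I * y * z = Complex.I * ((2 : ℝ) * (y * z)) by push_cast; ring]
  simp only [Complex.I_mul_re, Complex.im_ofReal_mul]; ring

theorem norm_kernel_le_div_pow {ap am : ℝ} (hap : 0 < ap) (ham : 0 < am) {z y : ℂ} {t E : ℝ}
    (ht : 0 < t) (hy : t ≤ |y.re|) (hE : Real.exp (-2 * (y * z).im) ≤ E) :
    ‖kernel ap am z y‖ ≤ E / (ap * am) / t ^ 3 := by
  have h1 : ap * t ≤ ‖Complex.sinh (ap * y)‖ :=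
    (mul_le_mul_of_nonneg_left hy hap.le).trans (mul_re_le_norm_sinh hap y)
  have h2 : am * t ≤ ‖Complex.sinh (am * y)‖ :=
    (mul_le_mul_of_nonneg_left hy ham.le).trans (mul_re_le_norm_sinh ham y)
  have h3 : t ≤ ‖y‖ := hy.trans (Complex.abs_re_le_norm y)
  have hE0 : 0 ≤ E := (Real.exp_pos _).le.trans hE
  rw [kernel, norm_div, norm_exp_two_I_mul, norm_mul, norm_mul]
  calc _ ≤ E / (t * (ap * t) * (am * t)) := by gcongr
    _ = _ := by field_simp

theorem sinh_mul_ne_zero_of_strip {c : ℝ} (hc : 0 < c) {y : ℂ} (hy : y ≠ 0)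
    (him : |y.im| < Real.pi / c) : Complex.sinh (c * y) ≠ 0 := by
  by_cases h : y.re = 0
  · apply sinh_ne_zero_of_im
    rw [Complex.im_ofReal_mul]
    have him' : |c * y.im| < Real.pi := by
      rw [abs_mul, abs_of_pos hc]; rwa [lt_div_iff₀' hc] at him
    have h0 : c * y.im ≠ 0 := mul_ne_zero hc.ne' fun h' => hy (Complex.ext h h')
    intro hs
    exact h0 ((Real.sin_eq_zero_iff_of_lt_of_lt (neg_lt_of_abs_lt him') (lt_of_abs_lt him')).1 hs)
  · exact sinh_ne_zero_of_re (by simp [hc.ne', h])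

theorem exists_sinh_mul_eq (c : ℝ) : ∃ k : ℂ → ℂ, Differentiable ℂ k ∧
    ∀ y : ℂ, Complex.sinh (c * y) = y * (c * (1 + c ^ 2 * y ^ 2 / 6 + y ^ 4 * k y)) := by
  obtain ⟨k, hk, h⟩ := exists_sinh_eq
  refine ⟨fun y => c ^ 4 * k (c * y), by fun_prop, fun y => ?_⟩
  rw [h]; ring

theorem sinh_quotient_ne_zero {c : ℝ} (hc : 0 < c) {k : ℂ → ℂ}
    (hk : ∀ y : ℂ, Complex.sinh (c * y) = y * (c * (1 + c ^ 2 * y ^ 2 / 6 + y ^ 4 * k y)))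
    {y : ℂ} (him : |y.im| < Real.pi / c) :
    (c * (1 + c ^ 2 * y ^ 2 / 6 + y ^ 4 * k y) : ℂ) ≠ 0 := by
  by_cases hy : y = 0
  · simp [hy, hc.ne']
  · intro h
    apply sinh_mul_ne_zero_of_strip hc hy him
    rw [hk, h, mul_zero]

/-- The Laurent expansion of the kernel at its triple pole. -/
theorem exists_kernel_remainder {ap am : ℝ} (hap : 0 < ap) (ham : 0 < am) (z : ℂ) :
    ∃ R : ℂ → ℂ, DifferentiableOn ℂ R {y | |y.im| < Real.pi / ap ∧ |y.im| < Real.pi / am} ∧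
      ∀ y ≠ 0, |y.im| < Real.pi / ap → |y.im| < Real.pi / am →
        R y = kernel ap am z y - ((1 / (ap * am)) * (y ^ 3)⁻¹ +
          (2 * Complex.I * z / (ap * am)) * (y ^ 2)⁻¹ +
          ((-2 * z ^ 2 - (ap ^ 2 + am ^ 2) / 6) / (ap * am)) * y⁻¹) := by
  obtain ⟨e, he, hexp⟩ := exists_exp_eq 3
  obtain ⟨k, hk, hsA⟩ := exists_sinh_mul_eq ap
  obtain ⟨l, hl, hsB⟩ := exists_sinh_mul_eq am
  have hapc : (ap : ℂ) ≠ 0 := by exact_mod_cast hap.ne'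
  have hamc : (am : ℂ) ≠ 0 := by exact_mod_cast ham.ne'
  -- After removal of `a₊ a₋ y ^ 2`, the product of the two `sinh` is `1 + s y ^ 2 + L y ^ 4`. The
  -- numerator left after subtracting the polar part is then `y ^ 3 Q`, which cancels the triple
  -- pole.
  set s : ℂ := (ap ^ 2 + am ^ 2) / 6 with hs
  set L : ℂ → ℂ := fun y => ap ^ 2 * am ^ 2 / 36 + k y + l y +
    y ^ 2 * (ap ^ 2 / 6 * l y + am ^ 2 / 6 * k y) + y ^ 4 * (k y * l y) with hL
  set Q : ℂ → ℂ := fun y => (2 * Complex.I * z) ^ 3 * e (2 * Complex.I * y * z) -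
    2 * Complex.I * z * s - y * ((-2 * z ^ 2 - s) * s +
      L y * (1 + 2 * Complex.I * z * y + (-2 * z ^ 2 - s) * y ^ 2)) with hQ
  refine ⟨fun y => Q y / ((ap * (1 + ap ^ 2 * y ^ 2 / 6 + y ^ 4 * k y)) *
    (am * (1 + am ^ 2 * y ^ 2 / 6 + y ^ 4 * l y))), ?_, ?_⟩
  · rintro y ⟨h1, h2⟩
    have h3 := sinh_quotient_ne_zero hap hsA h1
    have h4 := sinh_quotient_ne_zero ham hsB h2
    have h5 := mul_ne_zero h3 h4
    apply DifferentiableAt.differentiableWithinAt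
    refine DifferentiableAt.div ?_ (by fun_prop) h5
    simp only [hQ, hL]
    fun_prop
  · intro y hy h1 h2
    have h3 := sinh_quotient_ne_zero hap hsA h1
    have h4 := sinh_quotient_ne_zero ham hsB h2
    have hnum : Complex.exp (2 * Complex.I * y * z) -
        (1 + 2 * Complex.I * z * y + (-2 * z ^ 2 - s) * y ^ 2) *
        ((1 + ap ^ 2 * y ^ 2 / 6 + y ^ 4 * k y) * (1 + am ^ 2 * y ^ 2 / 6 + y ^ 4 * l y)) =
        y ^ 3 * Q y := by
      rw [hexp]
      simp only [Finset.sum_range_succ, Finset.sum_range_zero, hQ, hL, hs, Nat.factorial]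
      push_cast
      linear_combination (2 * y ^ 2 * z ^ 2) * Complex.I_sq
    have hQe : Q y = (Complex.exp (2 * Complex.I * y * z) -
        (1 + 2 * Complex.I * z * y + (-2 * z ^ 2 - s) * y ^ 2) *
        ((1 + ap ^ 2 * y ^ 2 / 6 + y ^ 4 * k y) * (1 + am ^ 2 * y ^ 2 / 6 + y ^ 4 * l y))) /
        y ^ 3 := by
      rw [hnum]; field_simp
    beta_reduce
    rw [hQe, kernel, hsA, hsB]
    have h3' := right_ne_zero_of_mul h3
    have h4' := right_ne_zero_of_mul h4
    generalize 1 + (ap : ℂ) ^ 2 * y ^ 2 / 6 + y ^ 4 * k y = a at *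
    generalize 1 + (am : ℂ) ^ 2 * y ^ 2 / 6 + y ^ 4 * l y = b at *
    field_simp

/-- The denominator of the kernel is odd, so symmetrising turns the exponential into a sine. The
`y⁻²` term of the Laurent expansion is precisely the subtraction that makes the integrand of `g`
regular. -/
theorem kernel_add_kernel_neg (ap am : ℝ) (z : ℂ) {y : ℂ} (hap : (ap : ℂ) ≠ 0)
    (ham : (am : ℂ) ≠ 0) (hy : y ≠ 0) :
    kernel ap am z y + kernel ap am z (-y) - 2 * (2 * Complex.I * z / (ap * am)) * (y ^ 2)⁻¹ =
      4 * Complex.I * gIntegrand ap am z y := by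
  have h : Complex.sin (2 * y * z) = (Complex.exp (-(2 * Complex.I * y * z)) -
      Complex.exp (2 * Complex.I * y * z)) * Complex.I / 2 := by
    rw [Complex.sin]; ring_nf
  simp only [kernel, gIntegrand, h, mul_neg, neg_mul, Complex.sinh_neg]
  generalize Complex.exp (-(2 * Complex.I * y * z)) = e₁
  generalize Complex.exp (2 * Complex.I * y * z) = e₂
  by_cases hA : Complex.sinh (ap * y) = 0
  · simp [hA]; field_simp; ring
  by_cases hB : Complex.sinh (am * y) = 0
  · simp [hB]; field_simp; ring
  generalize Complex.sinh (ap * y) = a at *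
  generalize Complex.sinh (am * y) = b at *
  field_simp
  linear_combination (4 * (e₂ - e₁) * y * ap * am) * Complex.I_sq

theorem mem_strip_ofReal {ap am : ℝ} (hap : 0 < ap) (ham : 0 < am) (x : ℝ) :
    (x : ℂ) ∈ strip ap am := by
  show |(x : ℂ).im| < (ap + am) / 2
  simp; positivity

theorem integrableOn_gIntegrand {ap am : ℝ} (hap : 0 < ap) (ham : 0 < am) (x : ℝ) :
    IntegrableOn (fun u : ℝ => gIntegrand ap am x u) (Ioi 0) := by
  obtain ⟨C, hC⟩ := norm_gIntegrand_le (W := 1) (η := (ap + am) / 2) hap ham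
    (norm_nonneg (x : ℂ)) (by positivity)
  refine Integrable.mono' (integrableOn_mul_inv_one_add_sq C) ?_ ?_
  · refine ContinuousOn.aestronglyMeasurable ?_ measurableSet_Ioi
    refine (differentiableOn_gIntegrand hap ham x).continuousOn.comp (by fun_prop) ?_
    intro t ht; simpa using ht
  · refine (ae_restrict_iff' measurableSet_Ioi).2 (Eventually.of_forall fun t ht => ?_)
    simpa using hC x 1 t le_rfl (by simp) (by simp) (by simp) ht

theorem tendsto_div_pow_atTop (c : ℝ) {n : ℕ} (hn : n ≠ 0) :
    Tendsto (fun T : ℝ => c / T ^ n) atTop (𝓝 0) :=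
  tendsto_const_nhds.div_atTop (tendsto_pow_atTop hn)

theorem add_mul_I_ne_zero {c : ℝ} (hc : c ≠ 0) (u : ℝ) : (u : ℂ) + c * Complex.I ≠ 0 :=
  fun h => by simpa [hc] using congrArg Complex.im h

/-- The function `g_R` as a contour integral just above the real line. -/
theorem tendsto_integral_kernel_near {ap am : ℝ} (hap : 0 < ap) (ham : 0 < am) {x r : ℝ}
    (hx : 0 ≤ x) (hr : 0 < r) (hrp : r < Real.pi / ap) (hrm : r < Real.pi / am) :
    Tendsto (fun T : ℝ => ∫ u in -T..T, kernel ap am x (u + r * Complex.I)) atTop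
      (𝓝 (4 * Complex.I * gR ap am x)) := by
  have hapc : (ap : ℂ) ≠ 0 := by exact_mod_cast hap.ne'
  have hamc : (am : ℂ) ≠ 0 := by exact_mod_cast ham.ne'
  obtain ⟨R, hR, hRk⟩ := exists_kernel_remainder hap ham (x : ℂ)
  set N₀ : ℂ := 1 / (ap * am) with hN₀
  set N₁ : ℂ := 2 * Complex.I * x / (ap * am) with hN₁
  set N₂ : ℂ := (-2 * x ^ 2 - (ap ^ 2 + am ^ 2) / 6) / (ap * am) with hN₂
  set U : Set ℂ := {y | |y.im| < Real.pi / ap ∧ |y.im| < Real.pi / am} with hU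
  have hUo : IsOpen U := (isOpen_lt Complex.continuous_im.abs continuous_const).inter
    (isOpen_lt Complex.continuous_im.abs continuous_const)
  have hUconv : Convex ℝ U := by
    have : ∀ c : ℝ, Convex ℝ {y : ℂ | |y.im| < c} := fun c => by
      simp only [abs_lt]
      exact (convex_halfSpace_im_gt (-c)).inter (convex_halfSpace_im_lt c)
    exact (this _).inter (this _)
  have hUmem : ∀ u : ℝ, ∀ ρ ∈ uIcc 0 r, (u + ρ * Complex.I : ℂ) ∈ U := by
    intro u ρ hρ
    rw [uIcc_of_le hr.le] at hρ
    simp only [hU, mem_ofPred_eq, Complex.add_im, Complex.ofReal_im, Complex.mul_im,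
      Complex.ofReal_re, Complex.I_im, Complex.I_re, mul_one, mul_zero, add_zero, zero_add,
      abs_of_nonneg hρ.1]
    exact ⟨hρ.2.trans_lt hrp, hρ.2.trans_lt hrm⟩
  have hRc : ∀ ρ ∈ uIcc 0 r, Continuous fun u : ℝ => R (u + ρ * Complex.I) := fun ρ hρ =>
    hR.continuousOn.comp_continuous (by fun_prop) fun u => hUmem u ρ hρ
  have hshift := tendsto_integral_horizontal_sub (f := R) (r₀ := 0) (r₁ := r)
    (b := fun T => 1 / (ap * am) / T ^ 3 + (‖N₀‖ / T ^ 3 + ‖N₁‖ / T ^ 2 + ‖N₂‖ / T ^ 1))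
    hUconv hUo hR hUmem ?_ ?_
  -- On the real line, folding `[-T, T]` onto `[0, T]` cancels the odd polar terms `y⁻³` and `y⁻¹`.
  · have h0 : Tendsto (fun T : ℝ => ∫ u in -T..T, R (u + (0 : ℝ) * Complex.I)) atTop
        (𝓝 (4 * Complex.I * gIntegral ap am x)) := by
      have hlim := (intervalIntegral_tendsto_integral_Ioi 0 (integrableOn_gIntegrand hap ham x)
        tendsto_id).const_mul (4 * Complex.I)
      refine hlim.congr' ?_
      filter_upwards [eventually_gt_atTop 0] with T hT
      have hc : Continuous fun u : ℝ => R u := by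
        simpa using hRc 0 left_mem_uIcc
      have hc' : Continuous fun u : ℝ => R (-u) := by
        simpa [Function.comp_def] using hc.comp continuous_neg
      have e := intervalIntegral.integral_comp_neg (a := 0) (b := T) (fun u : ℝ => R u)
      rw [neg_zero] at e
      simp only [Complex.ofReal_zero, zero_mul, add_zero, id]
      rw [← intervalIntegral.integral_add_adjacent_intervals (b := 0)
        (hc.intervalIntegrable _ _) (hc.intervalIntegrable _ _), ← e,
        ← intervalIntegral.integral_const_mul, ← intervalIntegral.integral_add]
      · refine intervalIntegral.integral_congr_ae (Eventually.of_forall fun u hu => ?_)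
        rw [uIoc_of_le hT.le] at hu
        have hu0 : (u : ℂ) ≠ 0 := by exact_mod_cast hu.1.ne'
        have p1 : |(u : ℂ).im| < Real.pi / ap := by simp; positivity
        have p2 : |(u : ℂ).im| < Real.pi / am := by simp; positivity
        have p3 : |(-u : ℂ).im| < Real.pi / ap := by simp; positivity
        have p4 : |(-u : ℂ).im| < Real.pi / am := by simp; positivity
        rw [← kernel_add_kernel_neg ap am x hapc hamc hu0, Complex.ofReal_neg,
          hRk _ hu0 p1 p2, hRk _ (neg_ne_zero.2 hu0) p3 p4]
        ring
      · simpa using hc'.intervalIntegrable _ _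
      · exact hc.intervalIntegrable _ _
    have h1 := h0.sub hshift
    simp only [sub_sub_cancel, sub_zero] at h1
    -- Restoring the polar part on the lifted line: only `y⁻¹` contributes, by `-π i N₂ = 4 i (χ + α
    -- x² / 4)`.
    have h2 := ((((tendsto_integral_inv_pow hr.ne' two_ne_zero).const_mul N₀).add
      ((tendsto_integral_inv_pow hr.ne' one_ne_zero).const_mul N₁)).add
      ((tendsto_integral_inv hr).const_mul N₂))
    have h3 := h1.add h2
    have hval : 4 * Complex.I * gIntegral ap am x + (N₀ * 0 + N₁ * 0 +
        N₂ * (-Real.pi * Complex.I)) = 4 * Complex.I * gR ap am x := by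
      rw [gR, (isContinuation_g hap ham).2 (mem_strip_ofReal hap ham x), chi, alpha, hN₂]
      push_cast
      field_simp
      ring
    rw [hval] at h3
    refine h3.congr fun T => ?_
    have hinv : ∀ n : ℕ, Continuous fun u : ℝ => (((u : ℂ) + r * Complex.I) ^ n)⁻¹ := fun n =>
      Continuous.inv₀ (by fun_prop) fun u => pow_ne_zero _ (add_mul_I_ne_zero hr.ne' u)
    have hinv1 : Continuous fun u : ℝ => ((u : ℂ) + r * Complex.I)⁻¹ := by simpa using hinv 1
    have i1 : ∀ n : ℕ, IntervalIntegrable (fun u : ℝ => (((u : ℂ) + r * Complex.I) ^ n)⁻¹)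
      volume (-T) T := fun n => (hinv n).intervalIntegrable _ _
    have i2 : IntervalIntegrable (fun u : ℝ => ((u : ℂ) + r * Complex.I)⁻¹) volume (-T) T :=
      hinv1.intervalIntegrable _ _
    rw [← intervalIntegral.integral_const_mul, ← intervalIntegral.integral_const_mul,
      ← intervalIntegral.integral_const_mul, ← intervalIntegral.integral_add
        ((i1 _).const_mul _) ((i1 _).const_mul _),
      ← intervalIntegral.integral_add (((i1 _).const_mul _).add ((i1 _).const_mul _))
        (i2.const_mul _),
      ← intervalIntegral.integral_add ((hRc r right_mem_uIcc).intervalIntegrable _ _)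
        ((((i1 _).const_mul _).add ((i1 _).const_mul _)).add (i2.const_mul _))]
    refine intervalIntegral.integral_congr fun u _ => ?_
    have hm := hUmem u r right_mem_uIcc
    rw [hRk _ (add_mul_I_ne_zero hr.ne' u) hm.1 hm.2]
    ring
  · filter_upwards [eventually_gt_atTop 0] with T hT ρ hρ
    have hρ' := hρ
    rw [uIcc_of_le hr.le] at hρ'
    have main : ∀ u : ℝ, |u| = T → ‖R (u + ρ * Complex.I)‖ ≤
        1 / (ap * am) / T ^ 3 + (‖N₀‖ / T ^ 3 + ‖N₁‖ / T ^ 2 + ‖N₂‖ / T ^ 1) := by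
      intro u hu
      have hm := hUmem u ρ hρ
      set y : ℂ := u + ρ * Complex.I with hy
      have hre : y.re = u := by simp [hy]
      have him : y.im = ρ := by simp [hy]
      have hTy : T ≤ ‖y‖ := by rw [← hu, ← hre]; exact Complex.abs_re_le_norm y
      have hy0 : y ≠ 0 := norm_pos_iff.1 (hT.trans_le hTy)
      rw [hRk y hy0 hm.1 hm.2]
      refine (norm_sub_le _ _).trans (add_le_add ?_ ?_)
      · refine norm_kernel_le_div_pow hap ham hT (by rw [hre, hu]) ?_
        rw [Complex.im_mul_ofReal, him]
        exact Real.exp_le_one_iff.2 (by nlinarith [mul_nonneg hρ'.1 hx])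
      · refine (norm_add₃_le).trans ?_
        simp only [← div_eq_mul_inv, norm_div, norm_pow]
        rw [pow_one]
        gcongr
    exact ⟨main T (abs_of_pos hT), by simpa using main (-T) (by rw [abs_neg, abs_of_pos hT])⟩
  · have := (tendsto_div_pow_atTop (1 / (ap * am)) three_ne_zero).add
      (((tendsto_div_pow_atTop ‖N₀‖ three_ne_zero).add (tendsto_div_pow_atTop ‖N₁‖ two_ne_zero)).add
        (tendsto_div_pow_atTop ‖N₂‖ one_ne_zero))
    simpa using this

/-- The function `g_R` as a contour integral above the first pole of the kernel in the upper
half-plane. -/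
theorem tendsto_integral_kernel {ap am : ℝ} (hap : 0 < ap) (ham : 0 < am) {x r : ℝ}
    (hx : 0 ≤ x) (hr₁ : Real.pi / ap < r) (hr₂ : r < 2 * Real.pi / ap) (hrm : r < Real.pi / am) :
    Tendsto (fun T : ℝ => ∫ u in -T..T, kernel ap am x (u + r * Complex.I)) atTop
      (𝓝 (4 * Complex.I * (gR ap am x - ((1 / (2 * Real.sin (Real.pi * am / ap)) : ℝ) : ℂ) *
        ePlus ap (-2 * x)))) := by
  have hapc : (ap : ℂ) ≠ 0 := by exact_mod_cast hap.ne'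
  have hπ : (Real.pi : ℂ) ≠ 0 := by exact_mod_cast Real.pi_ne_zero
  set q : ℝ := Real.pi / ap with hq
  have hq0 : 0 < q := by positivity
  set r₀ : ℝ := q / 2 with hr₀
  have hr₀0 : 0 < r₀ := by positivity
  have hr₀q : r₀ < q := by rw [hr₀]; linarith
  have hr₀r : r₀ < r := hr₀q.trans hr₁
  have hnear := tendsto_integral_kernel_near hap ham hx hr₀0 hr₀q (hr₀r.trans hrm)
  obtain ⟨k, hk, hsA⟩ := exists_sinh_mul_eq ap
  set p : ℂ := q * Complex.I with hp
  set S : ℂ → ℂ := fun v => ap * (1 + ap ^ 2 * v ^ 2 / 6 + v ^ 4 * k v) with hS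
  have hSd : Differentiable ℂ S := by simp only [hS]; fun_prop
  set M : ℂ → ℂ := fun y => -Complex.exp (2 * Complex.I * y * x) /
    (y * Complex.sinh (am * y) * S (y - p)) with hM
  set U : Set ℂ := {y | 0 < y.im} ∩ ({y | y.im < 2 * Real.pi / ap} ∩ {y | y.im < Real.pi / am})
    with hU
  have hUo : IsOpen U := (isOpen_lt continuous_const Complex.continuous_im).inter
    ((isOpen_lt Complex.continuous_im continuous_const).inter
      (isOpen_lt Complex.continuous_im continuous_const))
  have hUconv : Convex ℝ U := (convex_halfSpace_im_gt 0).inter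
    ((convex_halfSpace_im_lt _).inter (convex_halfSpace_im_lt _))
  have hpU : p ∈ U := by
    have : p.im = q := by simp [hp]
    refine ⟨?_, ?_, ?_⟩ <;> simp only [mem_ofPred_eq, this]
    · exact hq0
    · exact hr₁.trans hr₂
    · exact hr₁.trans hrm
  have him : ∀ u ρ : ℝ, ((u : ℂ) + ρ * Complex.I).im = ρ := by intro u ρ; simp
  have hUmem : ∀ u : ℝ, ∀ ρ ∈ uIcc r₀ r, (u + ρ * Complex.I : ℂ) ∈ U := by
    intro u ρ hρ
    rw [uIcc_of_le hr₀r.le] at hρ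
    refine ⟨?_, ?_, ?_⟩ <;> simp only [mem_ofPred_eq, him]
    · exact hr₀0.trans_le hρ.1
    · exact hρ.2.trans_lt hr₂
    · exact hρ.2.trans_lt hrm
  have hB : ∀ y ∈ U, Complex.sinh (am * y) ≠ 0 := fun y hy =>
    sinh_mul_ne_zero_of_strip ham (fun h => by simpa [h] using hy.1)
      (by rw [abs_of_pos hy.1]; exact hy.2.2)
  have hSne : ∀ y ∈ U, S (y - p) ≠ 0 := by
    intro y hy
    refine sinh_quotient_ne_zero hap hsA ?_
    have : (y - p).im = y.im - q := by simp [hp]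
    rw [this, abs_lt]
    have h1 : 0 < y.im := hy.1
    have h2 : y.im < 2 * Real.pi / ap := hy.2.1
    rw [mul_div_assoc, ← hq] at h2
    constructor <;> rw [← hq] <;> linarith
  have hMd : DifferentiableOn ℂ M U := by
    intro y hy
    have hy0 : y ≠ 0 := fun h => by simpa [h] using hy.1
    have := mul_ne_zero (mul_ne_zero hy0 (hB y hy)) (hSne y hy)
    apply DifferentiableAt.differentiableWithinAt
    simp only [hM]
    fun_prop (disch := assumption)
  have hdd : DifferentiableOn ℂ (dslope M p) U :=
    (Complex.differentiableOn_dslope (hUo.mem_nhds hpU)).2 hMd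
  have hMk : ∀ y ∈ U, y ≠ p → dslope M p y = kernel ap am x y - M p * (y - p)⁻¹ := by
    intro y hy hyp
    have hyp' : y - p ≠ 0 := sub_ne_zero.2 hyp
    have hsinh : Complex.sinh (ap * y) = -((y - p) * S (y - p)) := by
      rw [← hsA, hp, mul_sub, hq]
      push_cast
      rw [show (ap : ℂ) * (Real.pi / ap * Complex.I) = Real.pi * Complex.I by field_simp,
        Complex.sinh_sub, Complex.sinh_mul_I, Complex.cosh_mul_I]
      simp
    rw [dslope_of_ne _ hyp, slope_def_field, sub_div, div_eq_mul_inv (M p), kernel, hsinh]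
    congr 1
    simp only [hM]
    have h1 := hB y hy
    have h2 := hSne y hy
    have hy0 : y ≠ 0 := fun h => by simpa [h] using hy.1
    field_simp
  have hMp : M p = ((1 / (Real.pi * Real.sin (Real.pi * am / ap)) : ℝ) : ℂ) *
      ePlus ap (-2 * x) := by
    simp only [hM, hS, sub_self, ePlus]
    rw [show (am : ℂ) * p = ((Real.pi * am / ap : ℝ) : ℂ) * Complex.I by
        rw [hp, hq]; push_cast; ring, Complex.sinh_mul_I, ← Complex.ofReal_sin,
      show 2 * Complex.I * p * x = Real.pi * (-2 * x) / ap by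
        rw [hp, hq]; push_cast; linear_combination (2 * Real.pi / ap * x : ℂ) * Complex.I_sq]
    by_cases hsin : ((Real.sin (Real.pi * am / ap) : ℝ) : ℂ) = 0
    · simp [hsin]
    · rw [hp, hq]
      push_cast at hsin ⊢
      field_simp
      simp
  have hline : ∀ ρ : ℝ, ρ ≠ q → ∀ u : ℝ, (u : ℂ) + ρ * Complex.I ≠ p := by
    intro ρ hρ u h
    exact hρ (by simpa [hp] using congrArg Complex.im h)
  have hsubp : ∀ u ρ : ℝ, (u : ℂ) + ρ * Complex.I - p = u + ((ρ - q : ℝ) : ℂ) * Complex.I := by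
    intro u ρ; rw [hp]; push_cast; ring
  have hsplit : ∀ ρ ∈ uIcc r₀ r, ρ ≠ q → ∀ T : ℝ,
      ∫ u in -T..T, kernel ap am x (u + ρ * Complex.I) =
        (∫ u in -T..T, dslope M p (u + ρ * Complex.I)) +
          M p * ∫ u in -T..T, ((u : ℂ) + ((ρ - q : ℝ) : ℂ) * Complex.I)⁻¹ := by
    intro ρ hρ hρq T
    have c1 : Continuous fun u : ℝ => dslope M p (u + ρ * Complex.I) :=
      hdd.continuousOn.comp_continuous (by fun_prop) fun u => hUmem u ρ hρ
    have c2 : Continuous fun u : ℝ => ((u : ℂ) + ((ρ - q : ℝ) : ℂ) * Complex.I)⁻¹ :=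
      Continuous.inv₀ (by fun_prop) (add_mul_I_ne_zero (sub_ne_zero.2 hρq))
    rw [← intervalIntegral.integral_const_mul, ← intervalIntegral.integral_add
      (c1.intervalIntegrable _ _) ((c2.intervalIntegrable _ _).const_mul _)]
    refine intervalIntegral.integral_congr fun u _ => ?_
    rw [hMk _ (hUmem u ρ hρ) (hline ρ hρq u), hsubp]
    ring
  have hshift := tendsto_integral_horizontal_sub (f := dslope M p) (r₀ := r₀) (r₁ := r)
    (b := fun T => 1 / (ap * am) / T ^ 3 + ‖M p‖ / T ^ 1) hUconv hUo hdd hUmem ?_ ?_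
  -- The integral of `(y - p)⁻¹` tends to `π i` below the pole and to `-π i` above it, so the
  -- crossing subtracts `2 π i M p`.
  · have h1 := (hnear.sub hshift).sub
      (((tendsto_integral_inv_of_neg (sub_neg.2 hr₀q)).const_mul (M p)).sub
        ((tendsto_integral_inv (sub_pos.2 hr₁)).const_mul (M p)))
    have hval : 4 * Complex.I * gR ap am x - 0 - (M p * (Real.pi * Complex.I) -
        M p * (-Real.pi * Complex.I)) = 4 * Complex.I * (gR ap am x -
          ((1 / (2 * Real.sin (Real.pi * am / ap)) : ℝ) : ℂ) * ePlus ap (-2 * x)) := by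
      rw [hMp]
      by_cases hsin : ((Real.sin (Real.pi * am / ap) : ℝ) : ℂ) = 0
      · simp [Complex.ofReal_eq_zero.1 hsin]
      · push_cast at hsin ⊢
        field_simp
        ring
    rw [hval] at h1
    refine h1.congr fun T => ?_
    rw [hsplit r₀ left_mem_uIcc hr₀q.ne, hsplit r right_mem_uIcc hr₁.ne']
    ring
  · filter_upwards [eventually_gt_atTop 0] with T hT ρ hρ
    have hρ' := hρ
    rw [uIcc_of_le hr₀r.le] at hρ'
    have main : ∀ u : ℝ, |u| = T → ‖dslope M p (u + ρ * Complex.I)‖ ≤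
        1 / (ap * am) / T ^ 3 + ‖M p‖ / T ^ 1 := by
      intro u hu
      have hm := hUmem u ρ hρ
      have hre' : ((u : ℂ) + ρ * Complex.I - p).re = u := by simp [hp]
      have hre : ((u : ℂ) + ρ * Complex.I).re = u := by simp
      have hTp : T ≤ ‖(u : ℂ) + ρ * Complex.I - p‖ := by
        rw [← hu]; conv_lhs => rw [← hre']
        exact Complex.abs_re_le_norm _
      have hne : (u : ℂ) + ρ * Complex.I ≠ p := sub_ne_zero.1 (norm_pos_iff.1 (hT.trans_le hTp))
      rw [hMk _ hm hne]
      refine (norm_sub_le _ _).trans (add_le_add ?_ ?_)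
      · refine norm_kernel_le_div_pow hap ham hT (by rw [hre, hu]) ?_
        rw [Complex.im_mul_ofReal, him]
        exact Real.exp_le_one_iff.2 (by nlinarith [mul_nonneg (hr₀0.le.trans hρ'.1) hx])
      · rw [norm_mul, norm_inv, ← div_eq_mul_inv, pow_one]
        gcongr
    exact ⟨main T (abs_of_pos hT), by simpa using main (-T) (by rw [abs_neg, abs_of_pos hT])⟩
  · simpa using (tendsto_div_pow_atTop (1 / (ap * am)) three_ne_zero).add
      (tendsto_div_pow_atTop ‖M p‖ one_ne_zero)

/-! ### Tilting the contour -/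

/-- Where `|Re y|` is not small, the real part alone bounds `sinh` from below. Otherwise `Im y`
stays in a compact subinterval of `(π / c, 2 π / c)`, where the sine has no zero. -/
theorem exists_le_norm_sinh_mul {c r : ℝ} (hc : 0 < c) (hr₁ : Real.pi / c < r)
    (hr₂ : r < 2 * Real.pi / c) :
    ∃ m : ℝ, 0 < m ∧ ∀ y : ℂ, r ≤ y.im → y.im ≤ r + |y.re| → m ≤ ‖Complex.sinh (c * y)‖ := by
  obtain ⟨ρ, hρ₁, hρ₂⟩ := exists_between hr₂
  obtain ⟨v, hv, hmin⟩ := isCompact_Icc.exists_isMinOn (nonempty_Icc.2 hρ₁.le)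
    (f := fun v : ℝ => |Real.sin (c * v)|) (by fun_prop)
  have hpos : 0 < |Real.sin (c * v)| := by
    rw [div_lt_iff₀' hc] at hr₁
    rw [lt_div_iff₀' hc] at hρ₂
    have h1 : Real.pi < c * v := hr₁.trans_le (mul_le_mul_of_nonneg_left hv.1 hc.le)
    have h2 : c * v < 2 * Real.pi := (mul_le_mul_of_nonneg_left hv.2 hc.le).trans_lt hρ₂
    have h3 : Real.sin (c * v - Real.pi) ≠ 0 :=
      (Real.sin_pos_of_pos_of_lt_pi (by linarith) (by linarith)).ne'
    rw [Real.sin_sub_pi] at h3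
    exact abs_pos.2 (neg_ne_zero.1 h3)
  refine ⟨min (c * (ρ - r)) |Real.sin (c * v)|,
    lt_min (mul_pos hc (sub_pos.2 hρ₁)) hpos, fun y h1 h2 => ?_⟩
  rcases le_total (ρ - r) |y.re| with h | h
  · exact (min_le_left _ _).trans
      ((mul_le_mul_of_nonneg_left h hc.le).trans (mul_re_le_norm_sinh hc y))
  · refine (min_le_right _ _).trans ((hmin (a := y.im) ⟨h1, by linarith⟩).trans ?_)
    simpa using abs_sin_im_le (c * y)

/-- Applied with `c = a₋`: a lower bound linear in `c`, from Jordan's inequality when `|Re y| ≤ 1`.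
It is the origin of the factor `1 / a₋`, hence of the `-1` in the exponent `δ λ - 1`. -/
theorem le_norm_sinh_mul_of_small {c r : ℝ} (hc : 0 < c) (hr : 0 < r)
    (hcr : c * (r + 1) ≤ Real.pi / 2) {y : ℂ} (h₁ : r ≤ y.im) (h₂ : y.im ≤ r + |y.re|) :
    min 1 (2 / Real.pi * r) * c ≤ ‖Complex.sinh (c * y)‖ := by
  rcases le_total 1 |y.re| with h | h
  · refine le_trans ?_ (mul_re_le_norm_sinh hc y)
    rw [mul_comm]
    exact mul_le_mul_of_nonneg_left ((min_le_left _ _).trans h) hc.le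
  · refine le_trans ?_ (abs_sin_im_le (c * y))
    rw [Complex.im_ofReal_mul]
    have h3 := Real.mul_le_sin (x := c * y.im) (by nlinarith) (by nlinarith)
    refine le_trans ?_ (h3.trans (le_abs_self _))
    calc _ ≤ 2 / Real.pi * r * c := mul_le_mul_of_nonneg_right (min_le_right _ _) hc.le
      _ ≤ 2 / Real.pi * y.im * c := by gcongr
      _ = _ := by ring

/-- The constant is chosen before `am`, which makes the final estimate uniform as `a₋ ↓ 0`. -/
theorem exists_norm_kernel_le {ap r : ℝ} (hap : 0 < ap) (hr₁ : Real.pi / ap < r)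
    (hr₂ : r < 2 * Real.pi / ap) : ∃ C : ℝ, ∀ am : ℝ, 0 < am → am * (r + 1) ≤ Real.pi / 2 →
      ∀ (z y : ℂ) (E : ℝ), 0 < |y.re| → r ≤ y.im → y.im ≤ r + |y.re| →
        Real.exp (-2 * (y * z).im) ≤ E →
        ‖kernel ap am z y‖ ≤ C * E / am * (1 + y.re ^ 2)⁻¹ := by
  have hr : 0 < r := lt_trans (by positivity) hr₁
  obtain ⟨m, hm, hmle⟩ := exists_le_norm_sinh_mul hap hr₁ hr₂
  set n : ℝ := min 1 (2 / Real.pi * r) with hn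
  have hn0 : 0 < n := lt_min one_pos (by positivity)
  refine ⟨2 * (1 / (r * m * n) + 1 / ap), fun am ham hamr z y E hy h₁ h₂ hE => ?_⟩
  have hE0 : 0 ≤ E := (Real.exp_pos _).le.trans hE
  have h3 : n * am ≤ ‖Complex.sinh (am * y)‖ := le_norm_sinh_mul_of_small ham hr hamr h₁ h₂
  have h4 : r ≤ ‖y‖ := h₁.trans ((le_abs_self _).trans (Complex.abs_im_le_norm y))
  have key := le_mul_inv_one_add_sq (x := ‖kernel ap am z y‖) (C₁ := E / (r * m * (n * am)))
    (C₂ := E / (ap * am)) hy (by positivity) (by positivity) (fun _ => ?_) (fun h => ?_)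
  · rw [sq_abs] at key
    refine key.trans_eq ?_
    congr 1
    field_simp
  · rw [kernel, norm_div, norm_exp_two_I_mul, norm_mul, norm_mul]
    have := hmle y h₁ h₂
    gcongr
  · refine (norm_kernel_le_div_pow hap ham hy le_rfl hE).trans ?_
    gcongr
    norm_num

theorem differentiableAt_kernel {ap am : ℝ} (hap : 0 < ap) (ham : 0 < am) (z : ℂ) {y : ℂ}
    (hy : y.re ≠ 0) : DifferentiableAt ℂ (kernel ap am z) y := by
  have h : y * Complex.sinh (ap * y) * Complex.sinh (am * y) ≠ 0 :=
    mul_ne_zero (mul_ne_zero (fun h => hy (by simp [h]))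
      (sinh_ne_zero_of_re (by simp [hap.ne', hy]))) (sinh_ne_zero_of_re (by simp [ham.ne', hy]))
  unfold kernel
  fun_prop (disch := assumption)

theorem differentiable_kernel (ap am : ℝ) (y : ℂ) :
    Differentiable ℂ fun z => kernel ap am z y := by
  unfold kernel
  fun_prop

/-- The integral of the kernel along the contour `|u| (i ± 1) + r i`. -/
noncomputable def kernelTilt (ap am r : ℝ) (z : ℂ) : ℂ :=
  (∫ t in Ioi (0 : ℝ), (1 + (1 : ℝ) * Complex.I) *
    kernel ap am z (r * Complex.I + t * (1 + (1 : ℝ) * Complex.I))) +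
  ∫ t in Ioi (0 : ℝ), (1 + (-1 : ℝ) * Complex.I) *
    kernel ap am z (r * Complex.I - t * (1 + (-1 : ℝ) * Complex.I))

/-- On a ray that starts at `r i`, the kernel is dominated by an integrable function. -/
theorem norm_kernel_ray_le {ap am r C : ℝ} (hC : ∀ (z y : ℂ) (E : ℝ), 0 < |y.re| → r ≤ y.im →
      y.im ≤ r + |y.re| → Real.exp (-2 * (y * z).im) ≤ E →
      ‖kernel ap am z y‖ ≤ C * E / am * (1 + y.re ^ 2)⁻¹)
    {z : ℂ} {t τ : ℝ} (ht : 0 < t) (hτ₀ : 0 ≤ τ) (hτ₁ : τ ≤ 1) (hz : |z.im| ≤ τ * z.re) :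
    ‖kernel ap am z (r * Complex.I + t * (1 + τ * Complex.I))‖ ≤
        C * Real.exp (-2 * r * z.re) / am * (1 + t ^ 2)⁻¹ ∧
      ‖kernel ap am z (r * Complex.I - t * (1 + (-τ : ℝ) * Complex.I))‖ ≤
        C * Real.exp (-2 * r * z.re) / am * (1 + t ^ 2)⁻¹ := by
  -- On both rays `Im (y z) = ± t Im z + (r + t τ) Re z ≥ r Re z`. The slope `τ = 0` is thus
  -- admissible only for real `z`.
  have hz' := abs_le.1 hz
  constructor
  · set y : ℂ := r * Complex.I + t * (1 + τ * Complex.I) with hy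
    have hre : y.re = t := by simp [hy]
    have him : y.im = r + t * τ := by simp [hy]
    have := hC z y (Real.exp (-2 * r * z.re)) (by rw [hre]; positivity)
      (by rw [him]; nlinarith) (by rw [him, hre, abs_of_pos ht]; nlinarith)
      (Real.exp_le_exp.2 (by rw [Complex.mul_im, hre, him]; nlinarith))
    rwa [hre] at this
  · set y : ℂ := r * Complex.I - t * (1 + (-τ : ℝ) * Complex.I) with hy
    have hre : y.re = -t := by simp [hy]
    have him : y.im = r + t * τ := by simp [hy]
    have := hC z y (Real.exp (-2 * r * z.re)) (by rw [hre, abs_neg]; positivity)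
      (by rw [him]; nlinarith) (by rw [him, hre, abs_neg, abs_of_pos ht]; nlinarith)
      (Real.exp_le_exp.2 (by rw [Complex.mul_im, hre, him]; nlinarith))
    rwa [hre, neg_sq] at this

theorem continuousOn_kernel_ray {ap am : ℝ} (hap : 0 < ap) (ham : 0 < am) (z : ℂ) (r τ : ℝ) :
    ContinuousOn (fun t : ℝ => kernel ap am z (r * Complex.I + t * (1 + τ * Complex.I)))
        (Ioi 0) ∧
      ContinuousOn (fun t : ℝ => kernel ap am z (r * Complex.I - t * (1 + τ * Complex.I)))
        (Ioi 0) := by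
  constructor <;> intro t ht
  · have h := (differentiableAt_kernel hap ham z (y := r * Complex.I + t * (1 + τ * Complex.I))
      (by simpa using (ne_of_gt ht))).continuousAt
    exact (h.comp (f := fun t : ℝ => (r * Complex.I + t * (1 + τ * Complex.I) : ℂ))
      (by fun_prop)).continuousWithinAt
  · have h := (differentiableAt_kernel hap ham z (y := r * Complex.I - t * (1 + τ * Complex.I))
      (by simpa using (ne_of_gt ht))).continuousAt
    exact (h.comp (f := fun t : ℝ => (r * Complex.I - t * (1 + τ * Complex.I) : ℂ))
      (by fun_prop)).continuousWithinAt

/-- For real `x` the kernel is dominated on the whole sectors between the horizontal and the tilted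
half-lines, so each half can be rotated about `r i` without changing its integral. -/
theorem tendsto_integral_kernelTilt {ap am r C x : ℝ} (hap : 0 < ap) (ham : 0 < am) (hx : 0 ≤ x)
    (hC : ∀ (z y : ℂ) (E : ℝ), 0 < |y.re| → r ≤ y.im →
      y.im ≤ r + |y.re| → Real.exp (-2 * (y * z).im) ≤ E →
      ‖kernel ap am z y‖ ≤ C * E / am * (1 + y.re ^ 2)⁻¹)
    (hcont : Continuous fun u : ℝ => kernel ap am x (u + r * Complex.I)) :
    Tendsto (fun T : ℝ => ∫ u in -T..T, kernel ap am x (u + r * Complex.I)) atTop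
      (𝓝 (kernelTilt ap am r x)) := by
  have hb : ∀ τ : ℝ, 0 ≤ τ → τ ≤ 1 → ∀ t : ℝ, 0 < t → _ := fun τ h0 h1 t ht =>
    norm_kernel_ray_le hC (z := (x : ℂ)) ht h0 h1 (by simpa using mul_nonneg h0 hx)
  have e1 := integral_ray_eq_of_le (f := fun y => kernel ap am x (r * Complex.I + y)) (τ₀ := 0)
    (τ₁ := 1) (C := C * Real.exp (-2 * r * (x : ℂ).re) / am) ?_ ?_
  have e2 := integral_ray_eq_of_le (f := fun y => kernel ap am x (r * Complex.I - y)) (τ₀ := 0)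
    (τ₁ := -1) (C := C * Real.exp (-2 * r * (x : ℂ).re) / am) ?_ ?_
  · have i1 : IntegrableOn (fun u : ℝ => kernel ap am x (r * Complex.I + u)) (Ioi 0) := by
      refine Integrable.mono' (integrableOn_mul_inv_one_add_sq
        (C * Real.exp (-2 * r * (x : ℂ).re) / am)) ?_ ?_
      · simpa using (continuousOn_kernel_ray hap ham x r 0).1.aestronglyMeasurable (μ := volume)
          measurableSet_Ioi
      · refine (ae_restrict_iff' measurableSet_Ioi).2 (Eventually.of_forall fun t ht => ?_)
        simpa using (hb 0 le_rfl zero_le_one t ht).1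
    have i2 : IntegrableOn (fun u : ℝ => kernel ap am x (r * Complex.I - u)) (Ioi 0) := by
      refine Integrable.mono' (integrableOn_mul_inv_one_add_sq
        (C * Real.exp (-2 * r * (x : ℂ).re) / am)) ?_ ?_
      · simpa using (continuousOn_kernel_ray hap ham x r 0).2.aestronglyMeasurable (μ := volume)
          measurableSet_Ioi
      · refine (ae_restrict_iff' measurableSet_Ioi).2 (Eventually.of_forall fun t ht => ?_)
        simpa using (hb 0 le_rfl zero_le_one t ht).2
    rw [kernelTilt, ← e1, ← e2]
    simp only [Complex.ofReal_zero, zero_mul, add_zero, one_mul, mul_one]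
    refine ((intervalIntegral_tendsto_integral_Ioi 0 i1 tendsto_id).add
      (intervalIntegral_tendsto_integral_Ioi 0 i2 tendsto_id)).congr fun T => ?_
    have e := intervalIntegral.integral_comp_neg (a := 0) (b := T)
      (fun u : ℝ => kernel ap am x (u + r * Complex.I))
    rw [neg_zero] at e
    rw [← intervalIntegral.integral_add_adjacent_intervals (b := 0)
      (hcont.intervalIntegrable _ _) (hcont.intervalIntegrable _ _), ← e, add_comm]
    congr 1
    · refine intervalIntegral.integral_congr fun u _ => ?_
      simp only [Complex.ofReal_neg]
      congr 1; ring
    · refine intervalIntegral.integral_congr fun u _ => ?_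
      simp only [add_comm]
  · intro y hy
    have h := differentiableAt_kernel hap ham x (y := r * Complex.I - y)
      (by simpa using (ne_of_gt hy))
    exact (h.comp y (f := fun y : ℂ => r * Complex.I - y) (by fun_prop)).differentiableWithinAt
  · intro t ht τ hτ
    rw [uIcc_of_ge (by norm_num)] at hτ
    have := (hb (-τ) (by linarith [hτ.2]) (by linarith [hτ.1]) t ht).2
    rwa [neg_neg] at this
  · intro y hy
    have h := differentiableAt_kernel hap ham x (y := r * Complex.I + y)
      (by simpa using (ne_of_gt hy))
    exact (h.comp y (f := fun y : ℂ => r * Complex.I + y) (by fun_prop)).differentiableWithinAt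
  · intro t ht τ hτ
    rw [uIcc_of_le (by norm_num)] at hτ
    exact (hb τ hτ.1 hτ.2 t ht).1

theorem differentiableOn_kernelTilt {ap am r C : ℝ} (hap : 0 < ap) (ham : 0 < am) (hr : 0 ≤ r)
    (hC0 : 0 ≤ C) (hC : ∀ (z y : ℂ) (E : ℝ), 0 < |y.re| → r ≤ y.im →
      y.im ≤ r + |y.re| → Real.exp (-2 * (y * z).im) ≤ E →
      ‖kernel ap am z y‖ ≤ C * E / am * (1 + y.re ^ 2)⁻¹)
    {V : Set ℂ} (hV : IsOpen V) (hVle : ∀ z ∈ V, |z.im| ≤ z.re) :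
    DifferentiableOn ℂ (kernelTilt ap am r) V := by
  have hle : ∀ z ∈ V, ∀ t : ℝ, 0 < t →
      C * Real.exp (-2 * r * z.re) / am * (1 + t ^ 2)⁻¹ ≤ C / am * (1 + t ^ 2)⁻¹ := by
    intro z hz t _
    have h0 : 0 ≤ z.re := (abs_nonneg _).trans (hVle z hz)
    have : Real.exp (-2 * r * z.re) ≤ 1 := Real.exp_le_one_iff.2 (by nlinarith [mul_nonneg hr h0])
    have : C * Real.exp (-2 * r * z.re) ≤ C := by nlinarith
    gcongr
  refine DifferentiableOn.add ?_ ?_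
  · refine differentiableOn_integral_of_dominated hV ((integrableOn_mul_inv_one_add_sq
      (C / am)).const_mul ‖(1 + (1 : ℝ) * Complex.I : ℂ)‖) ?_ ?_ ?_
    · intro z _
      exact ((continuousOn_kernel_ray hap ham z r 1).1.aestronglyMeasurable
        measurableSet_Ioi).const_mul _
    · exact Eventually.of_forall fun t =>
        ((differentiable_kernel ap am _).const_mul _).differentiableOn
    · refine (ae_restrict_iff' measurableSet_Ioi).2 (Eventually.of_forall fun t ht z hz => ?_)
      rw [norm_mul]
      refine mul_le_mul_of_nonneg_left (le_trans ?_ (hle z hz t ht)) (norm_nonneg _)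
      exact (norm_kernel_ray_le hC ht zero_le_one le_rfl (by simpa using hVle z hz)).1
  · refine differentiableOn_integral_of_dominated hV ((integrableOn_mul_inv_one_add_sq
      (C / am)).const_mul ‖(1 + (-1 : ℝ) * Complex.I : ℂ)‖) ?_ ?_ ?_
    · intro z _
      exact ((continuousOn_kernel_ray hap ham z r (-1)).2.aestronglyMeasurable
        measurableSet_Ioi).const_mul _
    · exact Eventually.of_forall fun t =>
        ((differentiable_kernel ap am _).const_mul _).differentiableOn
    · refine (ae_restrict_iff' measurableSet_Ioi).2 (Eventually.of_forall fun t ht z hz => ?_)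
      rw [norm_mul]
      refine mul_le_mul_of_nonneg_left (le_trans ?_ (hle z hz t ht)) (norm_nonneg _)
      exact (norm_kernel_ray_le hC ht zero_le_one le_rfl (by simpa using hVle z hz)).2

theorem norm_kernelTilt_le {ap am r C : ℝ}
    (hC : ∀ (z y : ℂ) (E : ℝ), 0 < |y.re| → r ≤ y.im →
      y.im ≤ r + |y.re| → Real.exp (-2 * (y * z).im) ≤ E →
      ‖kernel ap am z y‖ ≤ C * E / am * (1 + y.re ^ 2)⁻¹)
    {z : ℂ} (hz : |z.im| ≤ z.re) :
    ‖kernelTilt ap am r z‖ ≤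
      (∫ t in Ioi (0 : ℝ), 4 * C * (1 + t ^ 2)⁻¹) * Real.exp (-2 * r * z.re) / am := by
  have hbound : IntegrableOn (fun t : ℝ => 2 * (C * Real.exp (-2 * r * z.re) / am *
      (1 + t ^ 2)⁻¹)) (Ioi 0) := (integrableOn_mul_inv_one_add_sq _).const_mul 2
  have hn : ∀ c : ℝ, |c| = 1 → ‖(1 + c * Complex.I : ℂ)‖ ≤ 2 := by
    intro c hc
    refine (norm_add_le _ _).trans ?_
    simp [hc]; norm_num
  have h1 := norm_integral_le_of_norm_le (μ := volume.restrict (Ioi (0 : ℝ)))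
    (f := fun t : ℝ => (1 + (1 : ℝ) * Complex.I) *
      kernel ap am z (r * Complex.I + t * (1 + (1 : ℝ) * Complex.I))) hbound
    ((ae_restrict_iff' measurableSet_Ioi).2 (Eventually.of_forall fun t ht => by
      rw [norm_mul]
      exact mul_le_mul (hn 1 (by simp))
        (norm_kernel_ray_le hC ht zero_le_one le_rfl (by simpa using hz)).1
        (norm_nonneg _) zero_le_two))
  have h2 := norm_integral_le_of_norm_le (μ := volume.restrict (Ioi (0 : ℝ)))
    (f := fun t : ℝ => (1 + (-1 : ℝ) * Complex.I) *
      kernel ap am z (r * Complex.I - t * (1 + (-1 : ℝ) * Complex.I))) hbound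
    ((ae_restrict_iff' measurableSet_Ioi).2 (Eventually.of_forall fun t ht => by
      rw [norm_mul]
      exact mul_le_mul (hn (-1) (by simp))
        (norm_kernel_ray_le hC ht zero_le_one le_rfl (by simpa using hz)).2
        (norm_nonneg _) zero_le_two))
  refine (norm_add_le _ _).trans ((add_le_add h1 h2).trans_eq ?_)
  simp only [integral_const_mul]
  ring

/-! ### Uniqueness -/

/-- Holomorphic functions on a convex open set that agree on the positive half-line agree. -/
theorem eqOn_of_eq_ofReal {f₁ f₂ : ℂ → ℂ} {V : Set ℂ} (hV : IsOpen V) (hVc : Convex ℝ V)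
    (h1V : (1 : ℂ) ∈ V) (h₁ : DifferentiableOn ℂ f₁ V) (h₂ : DifferentiableOn ℂ f₂ V)
    (h : ∀ x : ℝ, 0 < x → f₁ x = f₂ x) : EqOn f₁ f₂ V := by
  refine AnalyticOnNhd.eqOn_of_preconnected_of_frequently_eq (h₁.analyticOnNhd hV)
    (h₂.analyticOnNhd hV) hVc.isPreconnected h1V ?_
  have ht : Tendsto (fun x : ℝ => (x : ℂ)) (𝓝[≠] 1) (𝓝[≠] (1 : ℂ)) := by
    refine tendsto_nhdsWithin_iff.2 ⟨?_, ?_⟩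
    · have := Complex.continuous_ofReal.tendsto 1
      rw [Complex.ofReal_one] at this
      exact this.mono_left nhdsWithin_le_nhds
    · filter_upwards [self_mem_nhdsWithin] with x hx
      simpa using hx
  refine ht.frequently (Eventually.frequently ?_)
  filter_upwards [nhdsWithin_le_nhds (lt_mem_nhds (zero_lt_one (α := ℝ)))] with x hx using h x hx

theorem mem_cutPlane_of_re_ne_zero {ap am : ℝ} {z : ℂ} (hz : z.re ≠ 0) : z ∈ cutPlane ap am :=
  fun h => hz h.1

/-- The integral is odd on the real axis, and the identity theorem extends this to the right
half-plane. Statements about `gL` thereby reduce to `gR`. -/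
theorem g_neg {ap am : ℝ} (hap : 0 < ap) (ham : 0 < am) {z : ℂ} (hz : 0 < z.re) :
    g ap am (-z) = -g ap am z := by
  have hg := isContinuation_g hap ham
  have hd : ∀ z : ℂ, z.re ≠ 0 → DifferentiableAt ℂ (g ap am) z := fun z hz =>
    hg.1.differentiableAt ((isOpen_cutPlane ap am).mem_nhds (mem_cutPlane_of_re_ne_zero hz))
  refine eqOn_of_eq_ofReal (f₁ := fun z => g ap am (-z)) (f₂ := fun z => -g ap am z)
    (V := {z : ℂ | 0 < z.re}) (isOpen_lt continuous_const Complex.continuous_re)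
    (convex_halfSpace_re_gt 0) (by simp) ?_ ?_ ?_ hz
  · intro w hw
    exact ((hd (-w) (by simpa using (ne_of_gt hw))).comp w
      (f := fun w : ℂ => -w) (by fun_prop)).differentiableWithinAt
  · intro w hw
    exact (hd w (ne_of_gt hw)).neg.differentiableWithinAt
  · intro x _
    have h := hg.2 (mem_strip_ofReal hap ham (-x))
    rw [Complex.ofReal_neg] at h
    rw [h, hg.2 (mem_strip_ofReal hap ham x), ← gRay_zero, gRay_neg]

theorem gL_neg {ap am : ℝ} (hap : 0 < ap) (ham : 0 < am) {z : ℂ} (hz : 0 < z.re) :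
    gL ap am (-z) = -gR ap am z := by
  rw [gL, gR, g_neg hap ham hz]; ring

/-! ### Asymptotics -/

/-- The central estimate. On the positive axis the horizontal integrals have two limits, one given
by `gR` minus the residue term and one by `kernelTilt`. Both are holomorphic on the cone, so they
agree there and the bound on the tilted contour applies. -/
theorem exists_norm_gR_sub_le {ap r : ℝ} (hap : 0 < ap) (hr₁ : Real.pi / ap < r)
    (hr₂ : r < 2 * Real.pi / ap) : ∃ C : ℝ, 0 ≤ C ∧ ∀ am : ℝ, 0 < am →
      am * (r + 1) ≤ Real.pi / 2 → ∀ z : ℂ, |z.im| < z.re →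
        ‖gR ap am z - ((1 / (2 * Real.sin (Real.pi * am / ap)) : ℝ) : ℂ) * ePlus ap (-2 * z)‖ ≤
          C * Real.exp (-2 * r * z.re) / am := by
  have hr : 0 < r := lt_trans (by positivity) hr₁
  obtain ⟨C', hC'⟩ := exists_norm_kernel_le hap hr₁ hr₂
  obtain ⟨C, hC0, hC⟩ : ∃ C : ℝ, 0 ≤ C ∧ ∀ am : ℝ, 0 < am → am * (r + 1) ≤ Real.pi / 2 →
      ∀ (z y : ℂ) (E : ℝ), 0 < |y.re| → r ≤ y.im → y.im ≤ r + |y.re| →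
        Real.exp (-2 * (y * z).im) ≤ E →
        ‖kernel ap am z y‖ ≤ C * E / am * (1 + y.re ^ 2)⁻¹ := by
    refine ⟨|C'|, abs_nonneg _, fun am ham h z y E h1 h2 h3 h4 =>
      (hC' am ham h z y E h1 h2 h3 h4).trans ?_⟩
    have hE0 : 0 ≤ E := (Real.exp_pos _).le.trans h4
    gcongr
    exact le_abs_self C'
  refine ⟨(∫ t in Ioi (0 : ℝ), 4 * C * (1 + t ^ 2)⁻¹) / 4,
    div_nonneg (integral_nonneg fun t => by positivity) (by norm_num),
    fun am ham hamr z hz => ?_⟩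
  have hrm : r < Real.pi / am := by
    rw [lt_div_iff₀' ham]; nlinarith [Real.pi_pos]
  set V : Set ℂ := {z | |z.im| < z.re} with hV
  have hVo : IsOpen V := isOpen_lt Complex.continuous_im.abs Complex.continuous_re
  have hVc : Convex ℝ V := by
    have : V = {z : ℂ | |z.im| - z.re < 0} := by ext z; simp [hV]
    rw [this]
    have hconv : ConvexOn ℝ univ (fun z : ℂ => |z.im| - z.re) := by
      have h1 := (convexOn_norm (E := ℝ) convex_univ).comp_linearMap Complex.imLm
      have h2 := (Complex.reLm.concaveOn convex_univ)
      exact h1.sub h2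
    simpa using hconv.convex_lt 0
  have hVre : ∀ z ∈ V, 0 < z.re := fun z hz => (abs_nonneg _).trans_lt hz
  have heq : EqOn (fun z => 4 * Complex.I * (gR ap am z -
      ((1 / (2 * Real.sin (Real.pi * am / ap)) : ℝ) : ℂ) * ePlus ap (-2 * z)))
      (kernelTilt ap am r) V := by
    refine eqOn_of_eq_ofReal hVo hVc (by simp [hV]) ?_
      (differentiableOn_kernelTilt hap ham hr.le hC0 (hC am ham hamr) hVo fun z hz => le_of_lt hz)
      ?_
    · intro w hw
      have hgd : DifferentiableAt ℂ (g ap am) w := (isContinuation_g hap ham).1.differentiableAt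
        ((isOpen_cutPlane ap am).mem_nhds (mem_cutPlane_of_re_ne_zero (hVre w hw).ne'))
      apply DifferentiableAt.differentiableWithinAt
      unfold gR ePlus
      fun_prop
    · intro x hx
      refine tendsto_nhds_unique (tendsto_integral_kernel hap ham hx.le hr₁ hr₂ hrm)
        (tendsto_integral_kernelTilt hap ham hx.le (hC am ham hamr) ?_)
      have hne : ∀ c : ℝ, 0 < c → Real.sin (c * r) ≠ 0 → ∀ u : ℝ,
          Complex.sinh (c * (u + r * Complex.I)) ≠ 0 := fun c _ h u =>
        sinh_ne_zero_of_im (by simpa using h)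
      have hA := hne ap hap (by
        have h1 : Real.pi < ap * r := by rwa [div_lt_iff₀' hap] at hr₁
        have h2 : ap * r < 2 * Real.pi := by rwa [lt_div_iff₀' hap] at hr₂
        have h3 := (Real.sin_pos_of_pos_of_lt_pi (x := ap * r - Real.pi) (by linarith)
          (by linarith)).ne'
        rw [Real.sin_sub_pi] at h3
        exact neg_ne_zero.1 h3)
      have hB := hne am ham (Real.sin_pos_of_pos_of_lt_pi (by positivity)
        (by rwa [lt_div_iff₀' ham] at hrm)).ne'
      unfold kernel
      refine Continuous.div (by fun_prop) (by fun_prop) fun u => ?_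
      exact mul_ne_zero (mul_ne_zero (add_mul_I_ne_zero hr.ne' u) (hA u)) (hB u)
  have h1 := norm_kernelTilt_le (hC am ham hamr) (le_of_lt hz)
  rw [← heq hz, norm_mul, norm_mul, Complex.norm_ofNat, Complex.norm_I] at h1
  have h2 : ∀ a b : ℝ, a / 4 * b / am = a * b / am / 4 := fun a b => by ring
  rw [h2, le_div_iff₀ (by norm_num)]
  linarith

theorem tendsto_sShift_atTop {ap : ℝ} (hap : 0 < ap) :
    Tendsto (sShift ap) (𝓝[>] 0) atTop := by
  refine Tendsto.const_mul_atTop (by positivity) ?_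
  simpa only [one_div, Function.comp_def] using
    Real.tendsto_log_atTop.comp (tendsto_inv_nhdsGT_zero (𝕜 := ℝ))

/-- The reason for the choice of `s`: a shift by `λ s` turns exponential decay in `z` into a power
of `a₋`. -/
theorem exp_neg_mul_sShift {ap am : ℝ} (hap : 0 < ap) (ham : 0 < am) (lam : ℝ) :
    Real.exp (-(2 * Real.pi / ap * (lam * sShift ap am))) = am ^ lam := by
  rw [Real.rpow_def_of_pos ham, sShift, one_div, Real.log_inv]
  congr 1
  field_simp

theorem ePlus_add_sShift {ap am : ℝ} (hap : 0 < ap) (ham : 0 < am) (lam : ℝ) (z : ℂ) :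
    ePlus ap (-2 * (z + (lam * sShift ap am : ℝ))) = (am ^ lam : ℝ) * ePlus ap (-2 * z) := by
  rw [← exp_neg_mul_sShift hap ham, Complex.ofReal_exp, ePlus, ePlus, ← Complex.exp_add]
  congr 1
  push_cast
  ring

/-- Points of a compact set shifted by `λ s` eventually lie in the cone `|Im z| < Re z`. -/
theorem eventually_abs_im_lt_re {ap lam : ℝ} (hap : 0 < ap) (hlam : 0 < lam) {K : Set ℂ}
    (hK : IsCompact K) : ∀ᶠ am : ℝ in 𝓝[>] 0, ∀ z ∈ K,
      |(z + (lam * sShift ap am : ℝ)).im| < (z + (lam * sShift ap am : ℝ)).re := by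
  obtain ⟨Z, hZ⟩ := hK.isBounded.exists_norm_le
  filter_upwards [((tendsto_sShift_atTop hap).const_mul_atTop hlam).eventually_gt_atTop (2 * Z)]
    with am h z hz
  have h1 := (Complex.abs_im_le_norm z).trans (hZ z hz)
  have h2 := abs_le.1 ((Complex.abs_re_le_norm z).trans (hZ z hz))
  simp only [Complex.add_im, Complex.ofReal_im, add_zero, Complex.add_re, Complex.ofReal_re]
  linarith [h2.1]

theorem exists_norm_gR_add_sShift_le {ap lam δ : ℝ} (hap : 0 < ap) (hlam : 0 < lam) (hδ₁ : 1 < δ)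
    (hδ₂ : δ < 2) {K : Set ℂ} (hK : IsCompact K) :
    ∃ C : ℝ, ∀ᶠ am : ℝ in 𝓝[>] 0, ∀ z ∈ K,
      ‖gR ap am (z + (lam * sShift ap am : ℝ)) -
        ((am ^ lam / (2 * Real.sin (Real.pi * am / ap)) : ℝ) : ℂ) * ePlus ap (-2 * z)‖ ≤
          C * am ^ (δ * lam - 1) := by
  obtain ⟨Z, hZ⟩ := hK.isBounded.exists_norm_le
  -- With `1 < δ < 2` this height separates the poles `i π / a₊` and `2 i π / a₊`.
  set r : ℝ := δ * Real.pi / ap with hr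
  have hr0 : 0 < r := by positivity
  obtain ⟨C, hC0, hC⟩ := exists_norm_gR_sub_le (r := r) hap
    (by rw [hr]; gcongr; nlinarith [Real.pi_pos]) (by rw [hr]; gcongr)
  -- The factor `exp (2 r Z)` absorbs `exp (-2 r Re z)` for `z ∈ K`; the shift supplies `a₋ ^ (δ
  -- λ)`.
  refine ⟨C * Real.exp (2 * r * Z), ?_⟩
  have hsmall : ∀ᶠ am : ℝ in 𝓝[>] 0, am * (r + 1) ≤ Real.pi / 2 := by
    have h : (0 : ℝ) < Real.pi / 2 / (r + 1) := by positivity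
    filter_upwards [nhdsWithin_le_nhds (gt_mem_nhds h)] with am ham
    exact ((lt_div_iff₀ (by positivity)).1 ham).le
  filter_upwards [self_mem_nhdsWithin, hsmall, eventually_abs_im_lt_re hap hlam hK]
    with am ham hamr hcone z hz
  have ham' : 0 < am := ham
  have h := hC am ham' hamr _ (hcone z hz)
  rw [ePlus_add_sShift hap ham', ← mul_assoc, ← Complex.ofReal_mul, one_div_mul_eq_div] at h
  refine h.trans ?_
  rw [Real.rpow_sub_one ham'.ne', ← exp_neg_mul_sShift hap ham' (δ * lam),
    show ∀ a b : ℝ, C * a * (b / am) = C * (a * b) / am from fun a b => by ring, ← Real.exp_add]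
  refine div_le_div_of_nonneg_right (mul_le_mul_of_nonneg_left (Real.exp_le_exp.2 ?_) hC0) ham'.le
  have h2 := abs_le.1 ((Complex.abs_re_le_norm z).trans (hZ z hz))
  have e : 2 * Real.pi / ap * (δ * lam * sShift ap am) = 2 * r * (lam * sShift ap am) := by
    rw [hr]; ring
  rw [e]
  simp only [Complex.add_re, Complex.ofReal_re]
  nlinarith [h2.1]

theorem tendstoUniformlyOn_gR {ap lam δ c : ℝ} (hap : 0 < ap) (hlam : 0 < lam) (hδ₁ : 1 < δ)
    (hδ₂ : δ < 2) (hδl : 1 < δ * lam) {K : Set ℂ} (hK : IsCompact K)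
    (hc : Tendsto (fun am : ℝ => am ^ lam / (2 * Real.sin (Real.pi * am / ap))) (𝓝[>] 0) (𝓝 c)) :
    TendstoUniformlyOn (fun (am : ℝ) (z : ℂ) => gR ap am (z + (lam * sShift ap am : ℝ)))
      (fun z => (c : ℂ) * ePlus ap (-2 * z)) (𝓝[>] 0) K := by
  obtain ⟨C, hC⟩ := exists_norm_gR_add_sShift_le hap hlam hδ₁ hδ₂ hK
  obtain ⟨M, hM⟩ := hK.exists_bound_of_continuousOn (f := fun z => ePlus ap (-2 * z))
    (by unfold ePlus; fun_prop)
  have hpow : Tendsto (fun am : ℝ => am ^ (δ * lam - 1)) (𝓝[>] 0) (𝓝 0) := by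
    have hp : 0 < δ * lam - 1 := by linarith
    have := (Real.continuousAt_rpow_const 0 (δ * lam - 1) (Or.inr hp.le)).tendsto
    rw [Real.zero_rpow hp.ne'] at this
    exact this.mono_left nhdsWithin_le_nhds
  have hlim : Tendsto (fun am : ℝ => C * am ^ (δ * lam - 1) +
      |am ^ lam / (2 * Real.sin (Real.pi * am / ap)) - c| * M) (𝓝[>] 0) (𝓝 0) := by
    have h1 := (hc.sub_const c).abs.mul_const M
    simpa using (hpow.const_mul C).add h1
  rw [Metric.tendstoUniformlyOn_iff]
  intro ε hε
  filter_upwards [hC, hlim.eventually_lt_const hε] with am h1 h2 z hz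
  refine lt_of_le_of_lt ?_ h2
  rw [dist_comm, dist_eq_norm]
  calc _ = ‖(gR ap am (z + (lam * sShift ap am : ℝ)) -
        ((am ^ lam / (2 * Real.sin (Real.pi * am / ap)) : ℝ) : ℂ) * ePlus ap (-2 * z)) +
        ((am ^ lam / (2 * Real.sin (Real.pi * am / ap)) - c : ℝ) : ℂ) * ePlus ap (-2 * z)‖ := by
        congr 1; push_cast; ring
    _ ≤ _ := by
        refine (norm_add_le _ _).trans (add_le_add (h1 z hz) ?_)
        rw [norm_mul, Complex.norm_real, Real.norm_eq_abs]
        exact mul_le_mul_of_nonneg_left (hM z hz) (abs_nonneg _)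

theorem tendstoUniformlyOn_gL {ap lam δ c : ℝ} (hap : 0 < ap) (hlam : 0 < lam) (hδ₁ : 1 < δ)
    (hδ₂ : δ < 2) (hδl : 1 < δ * lam) {K : Set ℂ} (hK : IsCompact K)
    (hc : Tendsto (fun am : ℝ => am ^ lam / (2 * Real.sin (Real.pi * am / ap))) (𝓝[>] 0) (𝓝 c)) :
    TendstoUniformlyOn (fun (am : ℝ) (z : ℂ) => gL ap am (z - (lam * sShift ap am : ℝ)))
      (fun z => -((c : ℂ) * ePlus ap (2 * z))) (𝓝[>] 0) K := by
  have hK' : IsCompact ((fun z : ℂ => -z) '' K) := hK.image continuous_neg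
  have h := tendstoUniformlyOn_gR hap hlam hδ₁ hδ₂ hδl hK' hc
  rw [Metric.tendstoUniformlyOn_iff] at h ⊢
  intro ε hε
  filter_upwards [h ε hε, eventually_abs_im_lt_re hap hlam hK', self_mem_nhdsWithin]
    with am h1 h2 ham z hz
  have hz' : -z ∈ (fun z : ℂ => -z) '' K := mem_image_of_mem _ hz
  have h3 := h1 _ hz'
  have h4 := gL_neg hap ham ((abs_nonneg _).trans_lt (h2 _ hz'))
  rw [neg_add, neg_neg, ← sub_eq_add_neg] at h4
  rw [h4, dist_neg_neg]
  rwa [show (-2 : ℂ) * -z = 2 * z by ring] at h3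

theorem tendsto_div_sin {ap : ℝ} (hap : 0 < ap) :
    Tendsto (fun am : ℝ => am / (2 * Real.sin (Real.pi * am / ap))) (𝓝[>] 0)
      (𝓝 (ap / (2 * Real.pi))) := by
  have hd : HasDerivAt (fun am : ℝ => 2 * Real.sin (Real.pi * am / ap)) (2 * Real.pi / ap) 0 := by
    have h1 : HasDerivAt (fun am : ℝ => Real.pi * am / ap) (Real.pi / ap) 0 := by
      simpa using ((hasDerivAt_id (0 : ℝ)).const_mul Real.pi).div_const ap
    refine (h1.sin.const_mul 2).congr_deriv ?_
    simp; ring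
  -- The quotient is the reciprocal of a slope at `0`, so its limit is the reciprocal of the
  -- derivative.
  have h2 := (hasDerivAt_iff_tendsto_slope_zero.1 hd).inv₀ (by positivity)
  rw [inv_div] at h2
  refine (h2.mono_left (nhdsWithin_mono 0 fun x hx => ne_of_gt hx)).congr fun am => ?_
  simp [div_eq_mul_inv, mul_comm am]

theorem tendsto_rpow_div_sin {ap lam : ℝ} (hap : 0 < ap) (hlam : 1 < lam) :
    Tendsto (fun am : ℝ => am ^ lam / (2 * Real.sin (Real.pi * am / ap))) (𝓝[>] 0) (𝓝 0) := by
  have hp : 0 < lam - 1 := by linarith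
  have h1 := (Real.continuousAt_rpow_const 0 (lam - 1) (Or.inr hp.le)).tendsto
  rw [Real.zero_rpow hp.ne'] at h1
  have h2 := (h1.mono_left nhdsWithin_le_nhds).mul (tendsto_div_sin hap)
  rw [zero_mul] at h2
  refine h2.congr' ?_
  filter_upwards [self_mem_nhdsWithin] with am ham
  rw [Real.rpow_sub_one (ne_of_gt ham), mul_div_assoc', div_mul_cancel₀ _ (ne_of_gt ham)]

end HypGamma

theorem mainTheorem9 (ap : ℝ) (hap : 0 < ap) :
    -- the continuation that defines `g` exists
    (∀ am : ℝ, 0 < am → HypGamma.IsContinuation ap am (HypGamma.g ap am)) ∧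
    -- the asymptotic estimate for `g_R`
    (∀ lam : ℝ, 1 / Real.sqrt 2 < lam → ∀ δ : ℝ, 1 < δ → δ < Real.sqrt 2 → 1 < δ * lam →
      ∀ K : Set ℂ, IsCompact K → ∃ C : ℝ, ∀ᶠ am : ℝ in 𝓝[>] 0, ∀ z ∈ K,
        ‖HypGamma.gR ap am (z + (lam * HypGamma.sShift ap am : ℝ))
            - ((am ^ lam / (2 * Real.sin (Real.pi * am / ap)) : ℝ) : ℂ)
              * HypGamma.ePlus ap (-2 * z)‖ ≤ C * am ^ (δ * lam - 1)) ∧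
    -- the limits for `λ = 1`
    (∀ K : Set ℂ, IsCompact K →
      TendstoUniformlyOn
        (fun (am : ℝ) (z : ℂ) => HypGamma.gR ap am (z + (HypGamma.sShift ap am : ℝ)))
        (fun z => ((ap / (2 * Real.pi) : ℝ) : ℂ) * HypGamma.ePlus ap (-2 * z)) (𝓝[>] 0) K ∧
      TendstoUniformlyOn
        (fun (am : ℝ) (z : ℂ) => HypGamma.gL ap am (z - (HypGamma.sShift ap am : ℝ)))
        (fun z => -(((ap / (2 * Real.pi) : ℝ) : ℂ) * HypGamma.ePlus ap (2 * z))) (𝓝[>] 0) K) ∧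
    -- the limits for `λ > 1`
    (∀ lam : ℝ, 1 < lam → ∀ K : Set ℂ, IsCompact K →
      TendstoUniformlyOn
        (fun (am : ℝ) (z : ℂ) => HypGamma.gR ap am (z + (lam * HypGamma.sShift ap am : ℝ)))
        (fun _ => 0) (𝓝[>] 0) K ∧
      TendstoUniformlyOn
        (fun (am : ℝ) (z : ℂ) => HypGamma.gL ap am (z - (lam * HypGamma.sShift ap am : ℝ)))
        (fun _ => 0) (𝓝[>] 0) K) := by
  have hsqrt : Real.sqrt 2 < 2 := by
    rw [Real.sqrt_lt' two_pos]; norm_num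
  refine ⟨fun am ham => HypGamma.isContinuation_g hap ham, ?_, ?_, ?_⟩
  · intro lam hlam δ hδ₁ hδ₂ _ K hK
    exact HypGamma.exists_norm_gR_add_sShift_le hap (lt_trans (by positivity) hlam) hδ₁
      (hδ₂.trans hsqrt) hK
  · intro K hK
    have hc : Tendsto (fun am : ℝ => am ^ (1 : ℝ) / (2 * Real.sin (Real.pi * am / ap))) (𝓝[>] 0)
        (𝓝 (ap / (2 * Real.pi))) := by
      simpa only [Real.rpow_one] using HypGamma.tendsto_div_sin hap
    -- Any `δ` in `(1, 2)` would do: for `λ ≥ 1` it gives `δ λ > 1`, so the error term vanishes in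
    -- the limit.
    have hR := HypGamma.tendstoUniformlyOn_gR (δ := 3 / 2) hap one_pos (by norm_num) (by norm_num)
      (by norm_num) hK hc
    have hL := HypGamma.tendstoUniformlyOn_gL (δ := 3 / 2) hap one_pos (by norm_num) (by norm_num)
      (by norm_num) hK hc
    simp only [one_mul] at hR hL
    exact ⟨hR, hL⟩
  · intro lam hlam K hK
    have hc := HypGamma.tendsto_rpow_div_sin hap hlam
    have hR := HypGamma.tendstoUniformlyOn_gR (δ := 3 / 2) hap (by linarith) (by norm_num)
      (by norm_num) (by linarith) hK hc
    have hL := HypGamma.tendstoUniformlyOn_gL (δ := 3 / 2) hap (by linarith) (by norm_num)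
      (by norm_num) (by linarith) hK hc
    simp only [Complex.ofReal_zero, zero_mul, neg_zero] at hR hL
    exact ⟨hR, hL⟩
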